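/- **Setting.** Let $J,N,N_p$ be the numbers of scalar unknowns, observations and particles per unknown, and $B\ge 1$ the batch size. Given measurement functions $f_n:\mathbb R^J\to\mathbb C$, data $r_n\in\mathbb C$ and a noise level $\eta>0$, let $$p(r\mid\theta)=\prod_{n=1}^N\frac1{\sqrt{2\pi}\,\eta}\exp\Big(-\frac{|r_n-f_n(\theta)|^2}{2\eta^2}\Big),\qquad p(\theta)=\prod_{j=1}^J p_j(\theta_j)$$ be the likelihood and the (independent) prior. Let $I_j=[\hat\theta_j-\Delta_j/2,\hat\theta_j+\Delta_j/2]$ and $\epsilon>0$. Assume that $p_j>0$ on $I_j$, and that $\ln p_j$ on $I_j$ and $\ln p(r\mid\cdot)$ on $\prod_j I_j$ are differentiable with Lipschitz continuous gradient (derivatives being taken within these sets). **Problem $\mathcal P_2$.** For positions $\mathbf p=(p_{j,n})$ and weights $\mathbf w=(w_{j,n})$, $1\le j\le J$, $1\le n\le N_p$, let $q(\cdot;\mathbf p,\mathbf w)=\prod_{j}\sum_{n}w_{j,n}\delta_{p_{j,n}}$. Minimize $$L(\mathbf p,\mathbf w)=\int q\ln\frac{q}{p(r\mid\theta)p(\theta)}\,d\theta:=\sum_{n_1,\dots,n_J}\tilde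 w\,\ln\frac{\tilde w}{p(r\mid\tilde{\mathbf p})\,p(\tilde{\mathbf p})},\quad \tilde w=\prod_j w_{j,n_j},\ \ \tilde{\mathbf p}=(p_{1,n_1},\dots,p_{J,n_J}),$$ subject to $p_{j,n}\in I_j$, $\epsilon\le w_{j,n}\le1$ and $\sum_n w_{j,n}=1$ for all $j,n$. A feasible $x^*=(\mathbf p^*,\mathbf w^*)$ is *stationary* if $L$ is differentiable at $x^*$ within the feasible set and its derivative in the direction $x-x^*$ is nonnegative for every feasible $x$. **Algorithm.** Start from a (possibly random) feasible point $(\mathbf p^{(0)},\mathbf w^{(0)})$ and from $\mathrm f^{(-1)}_{p_j}=\mathrm f^{(-1)}_{w_j}=0$. In iteration $t=0,1,\dots$, draw, conditionally on the past, i.i.d. samples $\theta^{(1)},\dots,\theta^{(B)}$ from $q(\cdot;\mathbf p^{(t)},\mathbf w^{(t)})$. In parallel for all $j$, set $$\mathrm f^{(t)}_{p_j}=(1-\rho^{(t)})\mathrm f^{(t-1)}_{p_j}+\frac{\rho^{(t)}}B\sum_{b=1}^B\Big(-w^{(t)}_{j,n}\,\partial_{p_{j,n}}\big[\ln p_j(p^{(t)}_{j,n})+\ln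 p(r\mid p^{(t)}_{j,n},\theta^{(b)}_{\sim j})\big]\Big)_{n},$$ $$\mathrm f^{(t)}_{w_j}=(1-\rho^{(t)})\mathrm f^{(t-1)}_{w_j}+\frac{\rho^{(t)}}B\sum_{b=1}^B\Big(\ln w^{(t)}_{j,n}+1-\ln p_j(p^{(t)}_{j,n})-\ln p(r\mid p^{(t)}_{j,n},\theta^{(b)}_{\sim j})\Big)_{n},$$ where $(s,\theta_{\sim j})$ denotes $\theta$ with its $j$-th entry replaced by $s$. Let $\bar{\mathbf p}^{(t)}_j$ and $\bar{\mathbf w}^{(t)}_j$ be the Euclidean projections of $\mathbf p^{(t)}_j-\Gamma^{(t)}_{p_j}\mathrm f^{(t)}_{p_j}$ and $\mathbf w^{(t)}_j-\Gamma^{(t)}_{w_j}\mathrm f^{(t)}_{w_j}$ onto the feasible sets of the positions and of the weights of the $j$-th unknown, and put $$\mathbf p^{(t+1)}_j=(1-\gamma^{(t)})\mathbf p^{(t)}_j+\gamma^{(t)}\bar{\mathbf p}^{(t)}_j,\qquad \mathbf w^{(t+1)}_j=(1-\gamma^{(t)})\mathbf w^{(t)}_j+\gamma^{(t)}\bar{\mathbf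 w}^{(t)}_j .$$ **Theorem.** Suppose that $\rho^{(t)}>0$, $\rho^{(t)}\to0$, $\sum_t\rho^{(t)}=\infty$, $\sum_t(\rho^{(t)})^2<\infty$; that $0\le\gamma^{(t)}\le1$, $\sum_t\gamma^{(t)}=\infty$ and $\gamma^{(t)}/\rho^{(t)}\to0$; and that $\Gamma_{\min}\le\Gamma^{(t)}_{p_j},\Gamma^{(t)}_{w_j}\le\Gamma_{\max}$ for all $t,j$, with constants $0<\Gamma_{\min}\le\Gamma_{\max}<\infty$. Then, almost surely, every limit point $(\mathbf p^*,\mathbf w^*)$ of $(\mathbf p^{(t)},\mathbf w^{(t)})_{t}$ is a stationary point of $\mathcal P_2$. -/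

import Mathlib

open MeasureTheory Filter Topology
open scoped NNReal

noncomputable section

namespace PSPVBI

/-- A family `x j n` of scalars, one for every variable `j` and every particle `n`
(positions, weights, or the corresponding gradient estimates). -/
abbrev Particles (J Np : ℕ) : Type := Fin J → Fin Np → ℝ

/-- The data of the estimation problem with `J` scalar unknowns and `N` complex observations
`r n = f n θ + noise`: measurement functions, observed data, noise level, prior densities of the
(independent) unknowns, centres and widths of the search intervals, lower bound on the weights. -/
structure Model (J N : ℕ) where
  f : Fin N → (Fin J → ℝ) → ℂ
  r : Fin N → ℂ
  η : ℝ
  prior : Fin J → ℝ → ℝ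
  center : Fin J → ℝ
  width : Fin J → ℝ
  ε : ℝ

namespace Model

variable {J N Np B : ℕ} (M : Model J N)

/-- The likelihood `p(r | θ)` of the observed data under white Gaussian noise. -/
def lik (θ : Fin J → ℝ) : ℝ :=
  ∏ n, (1 / (Real.sqrt (2 * Real.pi) * M.η)) *
    Real.exp (-(‖M.r n - M.f n θ‖ ^ 2 / (2 * M.η ^ 2)))

/-- The joint prior density `p(θ) = ∏ j, p(θ j)`. -/
def jointPrior (θ : Fin J → ℝ) : ℝ := ∏ j, M.prior j (θ j)

/-- The search interval of the `j`-th unknown. -/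
def interval (j : Fin J) : Set ℝ :=
  Set.Icc (M.center j - M.width j / 2) (M.center j + M.width j / 2)

/-- The search box of the vector of unknowns. -/
def box : Set (Fin J → ℝ) := {θ | ∀ j, θ j ∈ M.interval j}

/-- Admissible positions of the particles of the `j`-th unknown. -/
def posSet (Np : ℕ) (j : Fin J) : Set (Fin Np → ℝ) := {x | ∀ n, x n ∈ M.interval j}

/-- Admissible weights of the particles of one unknown. -/
def weightSet (Np : ℕ) : Set (Fin Np → ℝ) :=
  {v | ∑ n, v n = 1 ∧ ∀ n, M.ε ≤ v n ∧ v n ≤ 1}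

/-- The feasible set of the particle problem. -/
def feasible (Np : ℕ) : Set (Particles J Np × Particles J Np) :=
  {x | ∀ j, x.1 j ∈ M.posSet Np j ∧ x.2 j ∈ M.weightSet Np}

/-- The objective `∫ q ln (q / (p(r|θ) p(θ)))` for the mean-field particle distribution
`q = ∏ j, ∑ n, w j n • δ (p j n)`: the joint particle selected by `ν` sits at
`(p j (ν j))_j` and carries the mass `∏ j, w j (ν j)`. -/
def objective (x : Particles J Np × Particles J Np) : ℝ :=
  ∑ ν : Fin J → Fin Np, (∏ j, x.2 j (ν j)) *
    Real.log ((∏ j, x.2 j (ν j)) /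
      (M.lik (fun j => x.1 j (ν j)) * M.jointPrior (fun j => x.1 j (ν j))))

/-- First-order stationarity for minimizing the objective over the (convex) feasible set.
The value `D (y - x)` is the one-sided directional derivative, so it does not depend on the
choice of the derivative `D` within the feasible set. -/
def IsStationary (x : Particles J Np × Particles J Np) : Prop :=
  x ∈ M.feasible Np ∧
    ∃ D : (Particles J Np × Particles J Np) →L[ℝ] ℝ,
      HasFDerivWithinAt M.objective D (M.feasible Np) x ∧
        ∀ y ∈ M.feasible Np, 0 ≤ D (y - x)

/-- The instantaneous gradient with respect to the position `p j n` at the sample `θ`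
(only the coordinates of `θ` other than the `j`-th matter). Derivatives are taken within the
search interval, so they are one-sided at its end points. -/
def gradP (p w : Particles J Np) (θ : Fin J → ℝ) (j : Fin J) (n : Fin Np) : ℝ :=
  -(w j n) * derivWithin
    (fun s => Real.log (M.prior j s) + Real.log (M.lik (Function.update θ j s)))
    (M.interval j) (p j n)

/-- The instantaneous gradient with respect to the weight `w j n` at the sample `θ`. -/
def gradW (p w : Particles J Np) (θ : Fin J → ℝ) (j : Fin J) (n : Fin Np) : ℝ :=
  Real.log (w j n) + 1 - Real.log (M.prior j (p j n))
    - Real.log (M.lik (Function.update θ j (p j n)))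

end Model

/-- The variational distribution `∏ j, ∑ n, w j n • δ (p j n)` on `ℝ^J`. -/
def particleLaw {J Np : ℕ} (p w : Particles J Np) : Measure (Fin J → ℝ) :=
  Measure.pi fun j => ∑ n, ENNReal.ofReal (w j n) • Measure.dirac (p j n)

/-- `y` is the Euclidean projection of `x` onto `S`. -/
def IsProj {n : ℕ} (S : Set (Fin n → ℝ)) (x y : Fin n → ℝ) : Prop :=
  y ∈ S ∧ ∀ z ∈ S, ∑ i, (x i - y i) ^ 2 ≤ ∑ i, (x i - z i) ^ 2

/-- `φ` is differentiable within `S`, with a Lipschitz continuous derivative on `S`. -/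
def LipschitzGradientOn {E F : Type*} [NormedAddCommGroup E] [NormedSpace ℝ E]
    [NormedAddCommGroup F] [NormedSpace ℝ F] (φ : E → F) (S : Set E) : Prop :=
  ∃ (φ' : E → E →L[ℝ] F) (K : ℝ≥0),
    (∀ x ∈ S, HasFDerivWithinAt φ (φ' x) S x) ∧ LipschitzOnWith K φ' S

/-- Standing assumptions: positive noise level and weight bound; the priors are positive on the
search intervals; log-priors and log-likelihood have Lipschitz gradients on the search region. -/
structure Model.Regular {J N : ℕ} (M : Model J N) : Prop where
  noise_pos : 0 < M.η
  eps_pos : 0 < M.ε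
  prior_pos : ∀ j, ∀ s ∈ M.interval j, 0 < M.prior j s
  log_prior : ∀ j, LipschitzGradientOn (fun s => Real.log (M.prior j s)) (M.interval j)
  log_lik : LipschitzGradientOn (fun θ => Real.log (M.lik θ)) M.box

/-- The step-size rules for the gradient averaging (`ρ`) and the iterate averaging (`γ`). -/
structure StepRules (ρ γ : ℕ → ℝ) : Prop where
  rho_pos : ∀ t, 0 < ρ t
  rho_tendsto : Tendsto ρ atTop (𝓝 0)
  rho_sum : ¬ Summable ρ
  rho_sq_sum : Summable fun t => ρ t ^ 2
  gamma_mem : ∀ t, γ t ∈ Set.Icc (0 : ℝ) 1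
  gamma_sum : ¬ Summable γ
  ratio_tendsto : Tendsto (fun t => γ t / ρ t) atTop (𝓝 0)

/-- `p, w` are the iterates of the parallel stochastic particle algorithm from a feasible
starting point. `ℱ t` is the information available before the `t`-th mini-batch
`θ t · b`, `b : Fin B`, is drawn; given it, the batch is i.i.d. with the current particle
distribution. `fp (t + 1)`, `fw (t + 1)` are the averaged gradients formed in iteration `t`
(so that `fp 0 = 0`, `fw 0 = 0` are their values before iteration `0`), and `pbar t`, `wbar t`
the projected gradient steps; `Γp`, `Γw` are the step lengths of the latter. -/
structure IsRun {J N Np B : ℕ} (M : Model J N) (ρ γ : ℕ → ℝ) (Γp Γw : ℕ → Fin J → ℝ)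
    {Ω : Type*} {mΩ : MeasurableSpace Ω} (μ : Measure Ω) (ℱ : Filtration ℕ mΩ)
    (p w fp fw pbar wbar : ℕ → Ω → Particles J Np)
    (θ : ℕ → Ω → Fin B → Fin J → ℝ) : Prop where
  init : ∀ ω, (p 0 ω, w 0 ω) ∈ M.feasible Np
  adapted_p : ∀ t, Measurable[ℱ t] (p t)
  adapted_w : ∀ t, Measurable[ℱ t] (w t)
  adapted_sample : ∀ t, Measurable[ℱ (t + 1)] (θ t)
  sample_law : ∀ t, ∀ A : Set (Fin B → Fin J → ℝ), MeasurableSet A →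
    μ[(θ t ⁻¹' A).indicator (fun _ => (1 : ℝ)) | ℱ t] =ᵐ[μ]
      fun ω => (Measure.pi fun _ : Fin B => particleLaw (p t ω) (w t ω)).real A
  fp_zero : ∀ ω, fp 0 ω = 0
  fw_zero : ∀ ω, fw 0 ω = 0
  fp_succ : ∀ t ω j n, fp (t + 1) ω j n = (1 - ρ t) * fp t ω j n +
    ρ t / B * ∑ b, M.gradP (p t ω) (w t ω) (θ t ω b) j n
  fw_succ : ∀ t ω j n, fw (t + 1) ω j n = (1 - ρ t) * fw t ω j n +
    ρ t / B * ∑ b, M.gradW (p t ω) (w t ω) (θ t ω b) j n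
  pbar_proj : ∀ t ω j,
    IsProj (M.posSet Np j) (fun n => p t ω j n - Γp t j * fp (t + 1) ω j n) (pbar t ω j)
  wbar_proj : ∀ t ω j,
    IsProj (M.weightSet Np) (fun n => w t ω j n - Γw t j * fw (t + 1) ω j n) (wbar t ω j)
  p_succ : ∀ t ω j n, p (t + 1) ω j n = (1 - γ t) * p t ω j n + γ t * pbar t ω j n
  w_succ : ∀ t ω j n, w (t + 1) ω j n = (1 - γ t) * w t ω j n + γ t * wbar t ω j n

end PSPVBI

end

/-!
The averaged gradients run on a faster time scale than the iterates: since `γ / ρ → 0`, the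
gradient of the objective `L` hardly moves while the averaging forgets its past. Writing `f` for
the averaged gradient and `G` for the gradient of `L`, the Lyapunov function `E L + E ‖f - G‖²`
therefore decreases up to errors of order `ρ²`, which are summable; here the noise is conditionally
centered, and the variational inequality of the projection gives
`⟪f, x̄ - x⟫ ≤ -c ‖x̄ - x‖²` for the projected point `x̄`. Hence `∑ γ ‖x̄ - x‖²` and
`∑ γ ‖f - G‖²` converge almost surely.

For a fixed feasible `y`, the first-order gap `max ⟪G x, x - y⟫ 0` is bounded by a multiple of
`‖x̄ - x‖ + ‖f - G‖`, so its square is summable with weights `γ`. As it changes by `O(γ)` in each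
step and `∑ γ = ∞`, it tends to `0`, and limit points inherit `0 ≤ ⟪G z, y - z⟫` by continuity.
-/

namespace PSPVBI

section RealSequences

theorem summable_of_eventually_descent {u h k : ℕ → ℝ} {m : ℝ} (hh : ∀ t, 0 ≤ h t)
    (hk0 : ∀ t, 0 ≤ k t) (hk : Summable k) (hm : ∀ t, m ≤ u t)
    (hu : ∀ᶠ t in atTop, u (t + 1) ≤ u t - h t + k t) : Summable h := by
  obtain ⟨T, hT⟩ := eventually_atTop.1 hu
  rw [← summable_nat_add_iff T]
  have hk' : Summable fun t => k (t + T) := (summable_nat_add_iff T).2 hk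
  have telescope : ∀ n, ∑ t ∈ Finset.range n, h (t + T)
      ≤ u T - u (n + T) + ∑ t ∈ Finset.range n, k (t + T) := by
    intro n
    induction n with
    | zero => simp
    | succ n ih =>
      rw [Finset.sum_range_succ, Finset.sum_range_succ, show n + 1 + T = n + T + 1 by omega]
      linarith [hT (n + T) (by omega)]
  refine summable_of_sum_range_le (c := u T - m + ∑' t, k (t + T)) (fun t => hh _) fun n => ?_
  linarith [telescope n, hm (n + T), hk'.sum_le_tsum (Finset.range n) fun t _ => hk0 _]

theorem frequently_lt_of_summable_mul_sq {γ r : ℕ → ℝ} (hγ : ∀ t, 0 ≤ γ t)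
    (hγs : ¬ Summable γ) (hs : Summable fun t => γ t * r t ^ 2) {δ : ℝ} (hδ : 0 < δ) :
    ∃ᶠ t in atTop, r t < δ := by
  intro hev
  refine hγs ((hs.mul_left (δ ^ 2)⁻¹).of_norm_bounded_eventually_nat ?_)
  filter_upwards [hev] with t ht
  rw [Real.norm_of_nonneg (hγ t), ← div_eq_inv_mul, le_div_iff₀ (by positivity)]
  exact mul_le_mul_of_nonneg_left (pow_le_pow_left₀ hδ.le (not_lt.1 ht) 2) (hγ t)

theorem dist_pow_three_le {x y d : ℝ} (hx : 0 ≤ x) (hy : 0 ≤ y) (hxy : dist x y ≤ d) :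
    dist (x ^ 3) (y ^ 3) ≤ 5 * (d * x ^ 2) + 3 * d ^ 3 := by
  have hd : 0 ≤ d := dist_nonneg.trans hxy
  have hsq : (x - y) ^ 2 ≤ d ^ 2 := by
    rw [← sq_abs, ← Real.dist_eq]
    exact pow_le_pow_left₀ dist_nonneg hxy 2
  have hfactor : dist (x ^ 3) (y ^ 3) = dist x y * (x ^ 2 + x * y + y ^ 2) := by
    rw [Real.dist_eq, Real.dist_eq, show x ^ 3 - y ^ 3 = (x - y) * (x ^ 2 + x * y + y ^ 2) by ring,
      abs_mul, abs_of_nonneg (by positivity : 0 ≤ x ^ 2 + x * y + y ^ 2)]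
  calc dist (x ^ 3) (y ^ 3) ≤ d * (5 * x ^ 2 + 3 * d ^ 2) := by
        rw [hfactor]
        exact mul_le_mul hxy (by nlinarith [sq_nonneg (y - 2 * x), sq_nonneg (x - y)])
          (by positivity) hd
    _ = 5 * (d * x ^ 2) + 3 * d ^ 3 := by ring

theorem tendsto_zero_of_tendsto_pow_zero {ι : Type*} {l : Filter ι} {r : ι → ℝ} {n : ℕ}
    (hr : ∀ t, 0 ≤ r t) (h : Tendsto (fun t => r t ^ n) l (𝓝 0)) : Tendsto r l (𝓝 0) := by
  refine tendsto_order.2 ⟨fun a ha => Eventually.of_forall fun t => ha.trans_le (hr t),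
    fun ε hε => ?_⟩
  filter_upwards [h.eventually_lt_const (pow_pos hε n)] with t ht
  exact lt_of_pow_lt_pow_left₀ n hε.le ht

-- The cubes `r t ^ 3` form a Cauchy sequence, and `r` comes arbitrarily close to `0`.
theorem tendsto_zero_of_summable_mul_sq {γ r : ℕ → ℝ} {C : ℝ} (hγ : ∀ t, γ t ∈ Set.Icc (0 : ℝ) 1)
    (hγs : ¬ Summable γ) (hγ2 : Summable fun t => γ t ^ 2) (hr : ∀ t, 0 ≤ r t)
    (hinc : ∀ t, dist (r t) (r (t + 1)) ≤ C * γ t) (hs : Summable fun t => γ t * r t ^ 2) :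
    Tendsto r atTop (𝓝 0) := by
  have hinc' : ∀ t, dist (r t) (r (t + 1)) ≤ |C| * γ t := fun t =>
    (hinc t).trans (mul_le_mul_of_nonneg_right (le_abs_self C) (hγ t).1)
  have hcube : ∀ t, (|C| * γ t) ^ 3 ≤ |C| ^ 3 * γ t ^ 2 := fun t => by
    rw [mul_pow]
    exact mul_le_mul_of_nonneg_left (pow_le_pow_of_le_one (hγ t).1 (hγ t).2 (by norm_num))
      (by positivity)
  have hsum : Summable fun t => 5 * (|C| * (γ t * r t ^ 2)) + 3 * (|C| ^ 3 * γ t ^ 2) :=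
    ((hs.mul_left _).mul_left _).add ((hγ2.mul_left _).mul_left _)
  obtain ⟨l, hl⟩ := cauchySeq_tendsto_of_complete <| cauchySeq_of_summable_dist <|
    Summable.of_nonneg_of_le (fun _ => dist_nonneg) (fun t => by
      linarith [dist_pow_three_le (hr t) (hr (t + 1)) (hinc' t), hcube t]) hsum
  have hl0 : l = 0 := by
    refine le_antisymm (le_of_forall_pos_le_add fun ε hε => ?_)
      (ge_of_tendsto' hl fun t => pow_nonneg (hr t) 3)
    have hδ : 0 < min 1 ε := lt_min one_pos hε
    refine le_of_tendsto_of_frequently hl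
      ((frequently_lt_of_summable_mul_sq (fun t => (hγ t).1) hγs hs hδ).mono fun t ht => ?_)
    calc r t ^ 3 ≤ min 1 ε ^ 3 := pow_le_pow_left₀ (hr t) ht.le 3
      _ ≤ min 1 ε := pow_le_of_le_one hδ.le (min_le_left _ _) (by norm_num)
      _ ≤ 0 + ε := by simp only [zero_add, min_le_right]
  exact tendsto_zero_of_tendsto_pow_zero hr (hl0 ▸ hl)

namespace StepRules

variable {ρ γ : ℕ → ℝ} (h : StepRules ρ γ)
include h

theorem eventually_gamma_le {κ : ℝ} (hκ : 0 < κ) : ∀ᶠ t in atTop, γ t ≤ κ * ρ t := by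
  filter_upwards [h.ratio_tendsto.eventually_lt_const hκ] with t ht
  exact ((div_lt_iff₀ (h.rho_pos t)).1 ht).le

theorem gamma_sq_summable : Summable fun t => γ t ^ 2 := by
  refine h.rho_sq_sum.of_norm_bounded_eventually_nat ?_
  filter_upwards [h.eventually_gamma_le one_pos] with t ht
  have hγ := (h.gamma_mem t).1
  rw [Real.norm_of_nonneg (by positivity)]
  exact pow_le_pow_left₀ hγ (by linarith) 2

theorem gamma_tendsto : Tendsto γ atTop (𝓝 0) := by
  simpa only [mul_zero, div_mul_cancel₀ _ (h.rho_pos _).ne'] using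
    h.ratio_tendsto.mul h.rho_tendsto

end StepRules

-- In this lemma and the next two, `a` stands for the mean objective value, `b` and `e` for the
-- mean square errors of the averaged gradient before and after its update, and `d` for `γ` times
-- the mean square distance to the projected point.
theorem mul_direction_error_le {ρ γ b e c σ : ℝ} (hρ0 : 0 ≤ ρ) (hρ1 : ρ ≤ 1) (hb : 0 ≤ b)
    (he0 : 0 ≤ e) (he : e ≤ (1 - ρ) ^ 2 * b + ρ ^ 2 * σ ^ 2) (hc : 0 ≤ c) (hγ : γ ≤ c / 2 * ρ) :
    γ * e ≤ c / 2 * (ρ * b + σ ^ 2 * ρ ^ 2) := by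
  have he' : e ≤ b + ρ * σ ^ 2 := by
    refine he.trans (add_le_add (mul_le_of_le_one_left hb ?_) ?_)
    · exact pow_le_one₀ (sub_nonneg.2 hρ1) (sub_le_self 1 hρ0)
    · exact mul_le_mul_of_nonneg_right (pow_le_of_le_one hρ0 hρ1 two_ne_zero) (sq_nonneg σ)
  calc γ * e ≤ c / 2 * ρ * (b + ρ * σ ^ 2) := mul_le_mul hγ he' he0 (by positivity)
    _ = c / 2 * (ρ * b + σ ^ 2 * ρ ^ 2) := by ring

theorem two_timescale_step {ρ γ a a' b b' e d c ℓ σ : ℝ} (hρ0 : 0 < ρ) (hρ1 : ρ ≤ 1)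
    (hγ0 : 0 ≤ γ) (hc : 0 < c) (hb : 0 ≤ b) (hd : 0 ≤ d) (he0 : 0 ≤ e)
    (hγ : γ ≤ c / 2 * ρ) (hγℓ : 2 * ℓ ^ 2 * γ ≤ c / 4 * ρ)
    (ha' : a' ≤ a - c / 2 * d + γ * (c⁻¹ * e))
    (he : e ≤ (1 - ρ) ^ 2 * b + ρ ^ 2 * σ ^ 2)
    (hb' : b' ≤ (1 + ρ) * e + (1 + ρ⁻¹) * (ℓ ^ 2 * (γ * d))) :
    a' + b' ≤ a + b - (c / 4 * d + 1 / 2 * (ρ * b)) + 3 * σ ^ 2 * ρ ^ 2 := by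
  have objective_part : γ * (c⁻¹ * e) ≤ 1 / 2 * (ρ * b + σ ^ 2 * ρ ^ 2) := by
    calc γ * (c⁻¹ * e) = c⁻¹ * (γ * e) := by ring
      _ ≤ c⁻¹ * (c / 2 * (ρ * b + σ ^ 2 * ρ ^ 2)) :=
        mul_le_mul_of_nonneg_left (mul_direction_error_le hρ0.le hρ1 hb he0 he hc.le hγ)
          (inv_nonneg.2 hc.le)
      _ = 1 / 2 * (ρ * b + σ ^ 2 * ρ ^ 2) := by field_simp
  have averaging_part : (1 + ρ) * e ≤ (1 - ρ) * b + 2 * σ ^ 2 * ρ ^ 2 := by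
    calc (1 + ρ) * e ≤ (1 + ρ) * ((1 - ρ) ^ 2 * b + ρ ^ 2 * σ ^ 2) := by gcongr
      _ = (1 - ρ ^ 2) * ((1 - ρ) * b) + (1 + ρ) * (σ ^ 2 * ρ ^ 2) := by ring
      _ ≤ 1 * ((1 - ρ) * b) + 2 * (σ ^ 2 * ρ ^ 2) := by
        have := sub_nonneg.2 hρ1
        gcongr <;> nlinarith
      _ = (1 - ρ) * b + 2 * σ ^ 2 * ρ ^ 2 := by ring
  have drift_part : (1 + ρ⁻¹) * (ℓ ^ 2 * (γ * d)) ≤ c / 4 * d := by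
    have hγd : (1 + ρ⁻¹) * (ℓ ^ 2 * γ) ≤ c / 4 := by
      calc (1 + ρ⁻¹) * (ℓ ^ 2 * γ) = ρ⁻¹ * (1 + ρ) * (ℓ ^ 2 * γ) := by field_simp; ring
        _ ≤ ρ⁻¹ * 2 * (ℓ ^ 2 * γ) := by gcongr; linarith
        _ ≤ ρ⁻¹ * (c / 4 * ρ) := by
          rw [mul_assoc, ← mul_assoc 2]
          gcongr
        _ = c / 4 := by field_simp
    linarith [mul_le_mul_of_nonneg_right hγd hd]
  have : 0 ≤ σ ^ 2 * ρ ^ 2 := by positivity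
  linarith

theorem summable_of_two_timescale {ρ γ : ℕ → ℝ} (hst : StepRules ρ γ) {a b d e : ℕ → ℝ}
    {m c ℓ σ : ℝ} (hc : 0 < c) (ha : ∀ t, m ≤ a t) (hb : ∀ t, 0 ≤ b t) (hd : ∀ t, 0 ≤ d t)
    (he0 : ∀ t, 0 ≤ e t)
    (haa : ∀ᶠ t in atTop, a (t + 1) ≤ a t - c / 2 * d t + γ t * (c⁻¹ * e t))
    (he : ∀ t, e t ≤ (1 - ρ t) ^ 2 * b t + ρ t ^ 2 * σ ^ 2)
    (hbb : ∀ t, b (t + 1) ≤ (1 + ρ t) * e t + (1 + (ρ t)⁻¹) * (ℓ ^ 2 * (γ t * d t))) :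
    Summable d ∧ Summable fun t => γ t * e t := by
  have hρb : ∀ t, 0 ≤ ρ t * b t := fun t => mul_nonneg (hst.rho_pos t).le (hb t)
  have hρ1 : ∀ᶠ t in atTop, ρ t ≤ 1 := hst.rho_tendsto.eventually_le_const one_pos
  have hγρ : ∀ᶠ t in atTop, γ t ≤ c / 2 * ρ t := hst.eventually_gamma_le (half_pos hc)
  have hγℓ : ∀ᶠ t in atTop, 2 * ℓ ^ 2 * γ t ≤ c / 4 * ρ t := by
    have hκ : 0 < c / 4 / (2 * ℓ ^ 2 + 1) := by positivity
    filter_upwards [hst.eventually_gamma_le hκ] with t ht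
    rw [div_mul_eq_mul_div, le_div_iff₀ (by positivity)] at ht
    linarith [(hst.gamma_mem t).1]
  have hsum : Summable fun t => c / 4 * d t + 1 / 2 * (ρ t * b t) := by
    refine summable_of_eventually_descent (u := fun t => a t + b t)
      (k := fun t => 3 * σ ^ 2 * ρ t ^ 2) (fun t => by have := hd t; have := hρb t; positivity)
      (fun t => by positivity) (hst.rho_sq_sum.mul_left _)
      (fun t => le_add_of_le_of_nonneg (ha t) (hb t)) ?_
    filter_upwards [hρ1, hγρ, hγℓ, haa] with t h1 h2 h3 h4
    exact two_timescale_step (hst.rho_pos t) h1 (hst.gamma_mem t).1 hc (hb t) (hd t) (he0 t)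
      h2 h3 h4 (he t) (hbb t)
  have hsum_d : Summable fun t => c / 4 * d t :=
    hsum.of_nonneg_of_le (fun t => by have := hd t; positivity) fun t => by linarith [hρb t]
  have hsum_b : Summable fun t => ρ t * b t :=
    (hsum.mul_left 2).of_nonneg_of_le hρb fun t => by nlinarith [hd t]
  refine ⟨(summable_mul_left_iff (by positivity)).1 hsum_d, ?_⟩
  refine ((hsum_b.add (hst.rho_sq_sum.mul_left (σ ^ 2))).mul_left
    (c / 2)).of_norm_bounded_eventually_nat ?_
  filter_upwards [hρ1, hγρ] with t h1 h2
  rw [Real.norm_of_nonneg (mul_nonneg (hst.gamma_mem t).1 (he0 t))]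
  exact mul_direction_error_le (hst.rho_pos t).le h1 (hb t) (he0 t) (he t) hc.le h2

end RealSequences

section AveragedGradientMethod

open scoped RealInnerProductSpace

variable {Ω : Type*} {m mΩ : MeasurableSpace Ω} {μ : Measure Ω}

theorem stronglyMeasurable_comp_of_continuousOn {X Y : Type*} [PseudoMetricSpace X]
    [TopologicalSpace Y] {K : Set X} (hK : IsCompact K) {g : X → Y} (hg : ContinuousOn g K)
    {x : Ω → X} (hx : StronglyMeasurable[m] x) (hxK : ∀ ω, x ω ∈ K) :
    StronglyMeasurable[m] fun ω => g (x ω) := by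
  borelize X
  have : CompactSpace K := isCompact_iff_compactSpace.1 hK
  have hx' : StronglyMeasurable[m] fun ω => (⟨x ω, hxK ω⟩ : K) :=
    (hx.measurable.subtype_mk).stronglyMeasurable
  exact (continuousOn_iff_continuous_domRestrict.1 hg).comp_stronglyMeasurable hx'

theorem memLp_comp_of_continuousOn {X F : Type*} [PseudoMetricSpace X] [NormedAddCommGroup F]
    [IsFiniteMeasure μ] {K : Set X} (hK : IsCompact K) {g : X → F} (hg : ContinuousOn g K)
    {x : Ω → X} (hx : StronglyMeasurable x) (hxK : ∀ ω, x ω ∈ K) (q : ENNReal) :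
    MemLp (fun ω => g (x ω)) q μ := by
  obtain ⟨C, hC⟩ := hK.exists_bound_of_continuousOn hg
  exact MemLp.of_bound (stronglyMeasurable_comp_of_continuousOn hK hg hx hxK).aestronglyMeasurable C
    (Eventually.of_forall fun ω => hC _ (hxK ω))

theorem ae_summable_of_summable_integral
    {F : ℕ → Ω → ℝ} (h0 : ∀ t ω, 0 ≤ F t ω) (hF : ∀ t, Integrable (F t) μ)
    (hs : Summable fun t => ∫ ω, F t ω ∂μ) : ∀ᵐ ω ∂μ, Summable fun t => F t ω := by
  have hmeas : ∀ t, AEMeasurable (fun ω => ENNReal.ofReal (F t ω)) μ :=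
    fun t => (hF t).1.aemeasurable.ennreal_ofReal
  have hfin : ∫⁻ ω, ∑' t, ENNReal.ofReal (F t ω) ∂μ ≠ ⊤ := by
    simp_rw [lintegral_tsum hmeas,
      ← ofReal_integral_eq_lintegral_ofReal (hF _) (Eventually.of_forall (h0 _))]
    exact hs.tsum_ofReal_ne_top
  filter_upwards [ae_lt_top' (AEMeasurable.tsum hmeas) hfin] with ω hω
  simpa only [ENNReal.toReal_ofReal (h0 _ ω)] using ENNReal.summable_toReal hω.ne

variable {E : Type*} [NormedAddCommGroup E] [InnerProductSpace ℝ E]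

theorem integrable_inner_of_memLp_two {g h : Ω → E} (hg : MemLp g 2 μ) (hh : MemLp h 2 μ) :
    Integrable (fun ω => ⟪g ω, h ω⟫) μ := by
  refine (hg.norm.integrable_mul hh.norm).mono' (hg.1.inner hh.1) (Eventually.of_forall fun ω => ?_)
  exact norm_inner_le_norm _ _

theorem integral_inner_eq_zero_of_condExp_eq_zero [CompleteSpace E] [IsFiniteMeasure μ]
    (hm : m ≤ mΩ) {g h : Ω → E} (hg : AEStronglyMeasurable[m] g μ) (hg2 : MemLp g 2 μ)
    (hh2 : MemLp h 2 μ) (hh : μ[h | m] =ᵐ[μ] 0) : ∫ ω, ⟪g ω, h ω⟫ ∂μ = 0 := by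
  have pull_out : μ[fun ω => ⟪g ω, h ω⟫ | m] =ᵐ[μ] fun ω => ⟪g ω, μ[h | m] ω⟫ :=
    condExp_bilin_of_aestronglyMeasurable_left (innerSL ℝ) hg
      (integrable_inner_of_memLp_two hg2 hh2) (hh2.integrable (by norm_num))
  rw [← integral_condExp hm, integral_congr_ae pull_out]
  refine integral_eq_zero_of_ae ?_
  filter_upwards [hh] with ω hω
  simp only [hω, Pi.zero_apply, inner_zero_right]

theorem le_add_inner_of_lipschitzOn_gradient [CompleteSpace E] {K : Set E} (hK : Convex ℝ K)
    {L : E → ℝ} {G : E → E} {ℓ : ℝ≥0} (hL : ∀ x ∈ K, HasGradientWithinAt L (G x) K x)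
    (hG : LipschitzOnWith ℓ G K) {x y : E} (hx : x ∈ K) (hy : y ∈ K) :
    L y ≤ L x + ⟪G x, y - x⟫ + ℓ * ‖y - x‖ ^ 2 := by
  have hseg : segment ℝ x y ⊆ K := hK.segment_subset hx hy
  have mean_value : ‖L y - L x - ⟪G x, y - x⟫‖ ≤ ℓ * ‖y - x‖ * ‖y - x‖ := by
    refine (convex_segment x y).norm_image_sub_le_of_norm_hasFDerivWithin_le'
      (f' := fun z => InnerProductSpace.toDual ℝ E (G z)) (φ := InnerProductSpace.toDual ℝ E (G x))
      (fun z hz => ((hL z (hseg hz)).hasFDerivWithinAt).mono hseg) (fun z hz => ?_)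
      (left_mem_segment ℝ x y) (right_mem_segment ℝ x y)
    rw [← map_sub, LinearIsometryEquiv.norm_map]
    refine (hG.norm_sub_le (hseg hz) hx).trans
      (mul_le_mul_of_nonneg_left (norm_sub_le_of_mem_segment hz) ℓ.2)
  linarith [(abs_le.1 mean_value).2]

/-- A run of the projected stochastic gradient method with averaged gradients for minimizing `L`
over `K`. Here `f (t + 1)` is the average of the gradient samples `G (x s) + ξ s`, `s ≤ t`, and
`xbar t` is the projection of the gradient step from `x t` along `f (t + 1)`; only the variational
inequalities `descent` and `optimality` of that projection are recorded. -/
structure AveragedGradientRun [CompleteSpace E] (K : Set E) (L : E → ℝ) (G : E → E) (ℓ : ℝ≥0)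
    (c D σ : ℝ) (ρ γ : ℕ → ℝ) (μ : Measure Ω) (ℱ : Filtration ℕ mΩ) (x f xbar ξ : ℕ → Ω → E) :
    Prop where
  convex : Convex ℝ K
  isCompact : IsCompact K
  gradient : ∀ x ∈ K, HasGradientWithinAt L (G x) K x
  lipschitz : LipschitzOnWith ℓ G K
  mem : ∀ t ω, x t ω ∈ K
  mem_bar : ∀ t ω, xbar t ω ∈ K
  x_succ : ∀ t ω, x (t + 1) ω = x t ω + γ t • (xbar t ω - x t ω)
  f_zero : ∀ ω, f 0 ω = 0
  f_succ : ∀ t ω, f (t + 1) ω = (1 - ρ t) • f t ω + ρ t • (G (x t ω) + ξ t ω)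
  c_pos : 0 < c
  D_nonneg : 0 ≤ D
  descent : ∀ t ω, ⟪f (t + 1) ω, xbar t ω - x t ω⟫ ≤ -c * ‖xbar t ω - x t ω‖ ^ 2
  optimality : ∀ t ω, ∀ y ∈ K,
    ⟪f (t + 1) ω, xbar t ω - y⟫ ≤ D * ‖xbar t ω - x t ω‖ * ‖xbar t ω - y‖
  adapted : ∀ t, StronglyMeasurable[ℱ t] (x t)
  noise_adapted : ∀ t, AEStronglyMeasurable[ℱ (t + 1)] (ξ t) μ
  noise_memLp : ∀ t, MemLp (ξ t) 2 μ
  noise_sq_le : ∀ t, ∫ ω, ‖ξ t ω‖ ^ 2 ∂μ ≤ σ ^ 2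
  noise_condExp : ∀ t, μ[ξ t | ℱ t] =ᵐ[μ] 0

namespace AveragedGradientRun

variable [CompleteSpace E] {K : Set E} {L : E → ℝ} {G : E → E} {ℓ : ℝ≥0} {c D σ : ℝ}
  {ρ γ : ℕ → ℝ} {ℱ : Filtration ℕ mΩ} {x f xbar ξ : ℕ → Ω → E}
  (h : AveragedGradientRun K L G ℓ c D σ ρ γ μ ℱ x f xbar ξ)
include h

theorem x_succ_sub (t : ℕ) (ω : Ω) :
    x (t + 1) ω - x t ω = γ t • (xbar t ω - x t ω) := by
  rw [h.x_succ, add_sub_cancel_left]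

theorem continuousOn_obj : ContinuousOn L K :=
  fun z hz => (h.gradient z hz).continuousWithinAt

theorem dist_le_diam {y z : E} (hy : y ∈ K) (hz : z ∈ K) : ‖y - z‖ ≤ Metric.diam K :=
  (dist_eq_norm y z).symm.trans_le (Metric.dist_le_diam_of_mem h.isCompact.isBounded hy hz)

theorem stronglyMeasurable_gradient (t : ℕ) : StronglyMeasurable[ℱ t] fun ω => G (x t ω) :=
  stronglyMeasurable_comp_of_continuousOn h.isCompact h.lipschitz.continuousOn (h.adapted t)
    (h.mem t)

theorem memLp_gradient [IsFiniteMeasure μ] (t : ℕ) : MemLp (fun ω => G (x t ω)) 2 μ :=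
  memLp_comp_of_continuousOn h.isCompact h.lipschitz.continuousOn
    ((h.adapted t).mono (ℱ.le t)) (h.mem t) 2

theorem integrable_obj [IsFiniteMeasure μ] (t : ℕ) : Integrable (fun ω => L (x t ω)) μ :=
  memLp_one_iff_integrable.1 <| memLp_comp_of_continuousOn h.isCompact h.continuousOn_obj
    ((h.adapted t).mono (ℱ.le t)) (h.mem t) 1

theorem aestronglyMeasurable_f (t : ℕ) : AEStronglyMeasurable[ℱ t] (f t) μ := by
  induction t with
  | zero => exact (funext h.f_zero : f 0 = fun _ => 0) ▸ aestronglyMeasurable_const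
  | succ t ih =>
    have hle : ℱ t ≤ ℱ (t + 1) := ℱ.mono t.le_succ
    rw [funext (h.f_succ t)]
    exact ((ih.mono hle).const_smul _).add
      ((((h.stronglyMeasurable_gradient t).mono hle).aestronglyMeasurable.add
        (h.noise_adapted t)).const_smul _)

theorem memLp_f [IsFiniteMeasure μ] (t : ℕ) : MemLp (f t) 2 μ := by
  induction t with
  | zero => exact (funext h.f_zero : f 0 = 0) ▸ MemLp.zero
  | succ t ih =>
    rw [funext (h.f_succ t)]
    exact (ih.const_smul _).add (((h.memLp_gradient t).add (h.noise_memLp t)).const_smul _)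

theorem memLp_tracking_error [IsFiniteMeasure μ] (t : ℕ) :
    MemLp (fun ω => f t ω - G (x t ω)) 2 μ :=
  (h.memLp_f t).sub (h.memLp_gradient t)

theorem integrable_sq_tracking_error [IsFiniteMeasure μ] (t : ℕ) :
    Integrable (fun ω => ‖f t ω - G (x t ω)‖ ^ 2) μ :=
  (h.memLp_tracking_error t).integrable_norm_pow two_ne_zero

theorem integrable_sq_direction_error [IsFiniteMeasure μ] (t : ℕ) :
    Integrable (fun ω => ‖f (t + 1) ω - G (x t ω)‖ ^ 2) μ :=
  ((h.memLp_f (t + 1)).sub (h.memLp_gradient t)).integrable_norm_pow two_ne_zero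

-- `xbar` need not be measurable, but `γ t * ‖xbar t - x t‖ ^ 2` is a function of the iterates.
theorem integrable_mul_sq_step [IsFiniteMeasure μ] (t : ℕ) :
    Integrable (fun ω => γ t * ‖xbar t ω - x t ω‖ ^ 2) μ := by
  have hx : ∀ t, MemLp (x t) 2 μ := fun t =>
    memLp_comp_of_continuousOn h.isCompact continuousOn_id ((h.adapted t).mono (ℱ.le t)) (h.mem t) 2
  have heq : ∀ ω, γ t * ‖xbar t ω - x t ω‖ ^ 2 = (γ t)⁻¹ * ‖x (t + 1) ω - x t ω‖ ^ 2 := fun ω => by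
    rcases eq_or_ne (γ t) 0 with h0 | h0
    · simp only [h0, zero_mul, inv_zero]
    · rw [h.x_succ_sub, norm_smul, mul_pow, Real.norm_eq_abs, sq_abs]
      field_simp
  simp_rw [heq]
  exact (((hx (t + 1)).sub (hx t)).integrable_norm_pow two_ne_zero).const_mul _

theorem integral_inner_noise_eq_zero [IsFiniteMeasure μ] (t : ℕ) :
    ∫ ω, ⟪f t ω - G (x t ω), ξ t ω⟫ ∂μ = 0 :=
  integral_inner_eq_zero_of_condExp_eq_zero (ℱ.le t)
    ((h.aestronglyMeasurable_f t).sub (h.stronglyMeasurable_gradient t).aestronglyMeasurable)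
    (h.memLp_tracking_error t) (h.noise_memLp t) (h.noise_condExp t)

theorem integral_sq_direction_error_le [IsFiniteMeasure μ] (t : ℕ) :
    ∫ ω, ‖f (t + 1) ω - G (x t ω)‖ ^ 2 ∂μ
      ≤ (1 - ρ t) ^ 2 * ∫ ω, ‖f t ω - G (x t ω)‖ ^ 2 ∂μ + ρ t ^ 2 * σ ^ 2 := by
  have expand : ∀ ω, ‖f (t + 1) ω - G (x t ω)‖ ^ 2 = (1 - ρ t) ^ 2 * ‖f t ω - G (x t ω)‖ ^ 2
      + 2 * ((1 - ρ t) * ρ t) * ⟪f t ω - G (x t ω), ξ t ω⟫ + ρ t ^ 2 * ‖ξ t ω‖ ^ 2 := by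
    intro ω
    rw [show f (t + 1) ω - G (x t ω) = (1 - ρ t) • (f t ω - G (x t ω)) + ρ t • ξ t ω by
      rw [h.f_succ]; module]
    rw [norm_add_sq_real, norm_smul, norm_smul, mul_pow, mul_pow, real_inner_smul_left,
      real_inner_smul_right, Real.norm_eq_abs, Real.norm_eq_abs, sq_abs, sq_abs]
    ring
  have int_error := (h.integrable_sq_tracking_error t).const_mul ((1 - ρ t) ^ 2)
  have int_cross := (integrable_inner_of_memLp_two (h.memLp_tracking_error t)
    (h.noise_memLp t)).const_mul (2 * ((1 - ρ t) * ρ t))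
  have int_noise := ((h.noise_memLp t).integrable_norm_pow two_ne_zero).const_mul (ρ t ^ 2)
  simp_rw [expand]
  rw [integral_add (by exact int_error.add int_cross) int_noise, integral_add int_error int_cross,
    integral_const_mul, integral_const_mul, integral_const_mul, h.integral_inner_noise_eq_zero t,
    mul_zero, add_zero]
  gcongr
  exact h.noise_sq_le t

theorem inner_gradient_step_le (t : ℕ) (ω : Ω) :
    ⟪G (x t ω), xbar t ω - x t ω⟫ ≤ -(3 * c / 4) * ‖xbar t ω - x t ω‖ ^ 2
      + c⁻¹ * ‖f (t + 1) ω - G (x t ω)‖ ^ 2 := by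
  have hc := h.c_pos
  have split : ⟪G (x t ω), xbar t ω - x t ω⟫ = ⟪f (t + 1) ω, xbar t ω - x t ω⟫
      - ⟪f (t + 1) ω - G (x t ω), xbar t ω - x t ω⟫ := by rw [inner_sub_left, sub_sub_cancel]
  have young : ∀ u v : ℝ, u * v ≤ c / 4 * v ^ 2 + c⁻¹ * u ^ 2 := fun u v => by
    have : c / 4 * v ^ 2 + c⁻¹ * u ^ 2 - u * v = c⁻¹ * (c / 2 * v - u) ^ 2 := by
      field_simp; ring
    linarith [mul_nonneg (inv_nonneg.2 hc.le) (sq_nonneg (c / 2 * v - u))]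
  have cauchy_schwarz := (abs_le.1 (abs_real_inner_le_norm (f (t + 1) ω - G (x t ω))
    (xbar t ω - x t ω))).1
  linarith [h.descent t ω, young ‖f (t + 1) ω - G (x t ω)‖ ‖xbar t ω - x t ω‖]

theorem obj_succ_le {t : ℕ} (hγ : 0 ≤ γ t) (hγℓ : ℓ * γ t ≤ c / 4) (ω : Ω) :
    L (x (t + 1) ω) ≤ L (x t ω) - c / 2 * (γ t * ‖xbar t ω - x t ω‖ ^ 2)
      + γ t * (c⁻¹ * ‖f (t + 1) ω - G (x t ω)‖ ^ 2) := by
  have upper := le_add_inner_of_lipschitzOn_gradient h.convex h.gradient h.lipschitz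
    (h.mem t ω) (h.mem (t + 1) ω)
  rw [h.x_succ_sub, real_inner_smul_right, norm_smul, Real.norm_of_nonneg hγ] at upper
  have first_order := mul_le_mul_of_nonneg_left (h.inner_gradient_step_le t ω) hγ
  have second_order : ℓ * γ t * (γ t * ‖xbar t ω - x t ω‖ ^ 2)
      ≤ c / 4 * (γ t * ‖xbar t ω - x t ω‖ ^ 2) :=
    mul_le_mul_of_nonneg_right hγℓ (by positivity)
  linarith

theorem sq_tracking_error_succ_le {t : ℕ} (hρ : 0 < ρ t) (ω : Ω) :
    ‖f (t + 1) ω - G (x (t + 1) ω)‖ ^ 2 ≤ (1 + ρ t) * ‖f (t + 1) ω - G (x t ω)‖ ^ 2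
      + (1 + (ρ t)⁻¹) * (ℓ ^ 2 * (γ t * (γ t * ‖xbar t ω - x t ω‖ ^ 2))) := by
  have triangle : ‖f (t + 1) ω - G (x (t + 1) ω)‖
      ≤ ‖f (t + 1) ω - G (x t ω)‖ + ℓ * ‖x (t + 1) ω - x t ω‖ := by
    rw [norm_sub_rev (x (t + 1) ω)]
    exact (norm_sub_le_norm_sub_add_norm_sub _ (G (x t ω)) _).trans
      (add_le_add_right (h.lipschitz.norm_sub_le (h.mem t ω) (h.mem (t + 1) ω)) _)
  have young : ∀ u v : ℝ, (u + v) ^ 2 ≤ (1 + ρ t) * u ^ 2 + (1 + (ρ t)⁻¹) * v ^ 2 := fun u v => by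
    have : (1 + ρ t) * u ^ 2 + (1 + (ρ t)⁻¹) * v ^ 2 - (u + v) ^ 2
        = (ρ t)⁻¹ * (ρ t * u - v) ^ 2 := by field_simp; ring
    linarith [mul_nonneg (inv_nonneg.2 hρ.le) (sq_nonneg (ρ t * u - v))]
  refine ((pow_le_pow_left₀ (norm_nonneg _) triangle 2).trans (young _ _)).trans_eq ?_
  rw [h.x_succ_sub, norm_smul, mul_pow, mul_pow, Real.norm_eq_abs, sq_abs]
  ring

theorem eventually_integral_obj_succ_le [IsFiniteMeasure μ] (hst : StepRules ρ γ) :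
    ∀ᶠ t in atTop, ∫ ω, L (x (t + 1) ω) ∂μ ≤ ∫ ω, L (x t ω) ∂μ
      - c / 2 * ∫ ω, γ t * ‖xbar t ω - x t ω‖ ^ 2 ∂μ
      + γ t * (c⁻¹ * ∫ ω, ‖f (t + 1) ω - G (x t ω)‖ ^ 2 ∂μ) := by
  have hγℓ : ∀ᶠ t in atTop, ℓ * γ t ≤ c / 4 := by
    refine (hst.gamma_tendsto.const_mul (ℓ : ℝ)).eventually_le_const ?_
    rw [mul_zero]
    linarith [h.c_pos]
  filter_upwards [hγℓ] with t ht
  have int_step := (h.integrable_mul_sq_step t).const_mul (c / 2)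
  have int_error := ((h.integrable_sq_direction_error t).const_mul c⁻¹).const_mul (γ t)
  have int_rhs := ((h.integrable_obj t).sub int_step).add int_error
  refine (integral_mono (h.integrable_obj (t + 1)) int_rhs
    (h.obj_succ_le (hst.gamma_mem t).1 ht)).trans_eq ?_
  rw [integral_add' ((h.integrable_obj t).sub int_step) int_error,
    integral_sub' (h.integrable_obj t) int_step]
  simp only [integral_const_mul]

theorem integral_sq_tracking_error_succ_le [IsFiniteMeasure μ] {t : ℕ} (hρ : 0 < ρ t) :
    ∫ ω, ‖f (t + 1) ω - G (x (t + 1) ω)‖ ^ 2 ∂μ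
      ≤ (1 + ρ t) * ∫ ω, ‖f (t + 1) ω - G (x t ω)‖ ^ 2 ∂μ
        + (1 + (ρ t)⁻¹) * (ℓ ^ 2 * (γ t * ∫ ω, γ t * ‖xbar t ω - x t ω‖ ^ 2 ∂μ)) := by
  have int_error := (h.integrable_sq_direction_error t).const_mul (1 + ρ t)
  have int_step := (((h.integrable_mul_sq_step t).const_mul (γ t)).const_mul
    ((ℓ : ℝ) ^ 2)).const_mul (1 + (ρ t)⁻¹)
  refine (integral_mono (h.integrable_sq_tracking_error (t + 1)) (int_error.add int_step)
    (h.sq_tracking_error_succ_le hρ)).trans_eq ?_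
  rw [integral_add' int_error int_step]
  simp only [integral_const_mul]

theorem exists_le_integral_obj [IsFiniteMeasure μ] : ∃ m : ℝ, ∀ t, m ≤ ∫ ω, L (x t ω) ∂μ := by
  obtain ⟨C, hC⟩ := h.isCompact.exists_bound_of_continuousOn h.continuousOn_obj
  exact ⟨∫ _, -C ∂μ, fun t => integral_mono (integrable_const _) (h.integrable_obj t)
    fun ω => (abs_le.1 (hC _ (h.mem t ω))).1⟩

theorem ae_summable [IsFiniteMeasure μ] (hst : StepRules ρ γ) :
    ∀ᵐ ω ∂μ, (Summable fun t => γ t * ‖xbar t ω - x t ω‖ ^ 2) ∧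
      Summable fun t => γ t * ‖f (t + 1) ω - G (x t ω)‖ ^ 2 := by
  have hγ : ∀ t, 0 ≤ γ t := fun t => (hst.gamma_mem t).1
  obtain ⟨m, hm⟩ := h.exists_le_integral_obj
  obtain ⟨sum_step, sum_error⟩ := summable_of_two_timescale hst h.c_pos hm
    (fun t => integral_nonneg fun ω => sq_nonneg ‖f t ω - G (x t ω)‖)
    (fun t => integral_nonneg fun ω => mul_nonneg (hγ t) (sq_nonneg ‖xbar t ω - x t ω‖))
    (fun t => integral_nonneg fun ω => sq_nonneg ‖f (t + 1) ω - G (x t ω)‖)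
    (h.eventually_integral_obj_succ_le hst) h.integral_sq_direction_error_le
    (fun t => h.integral_sq_tracking_error_succ_le (hst.rho_pos t))
  refine (ae_summable_of_summable_integral (fun t ω => mul_nonneg (hγ t) (sq_nonneg _))
    h.integrable_mul_sq_step sum_step).and (ae_summable_of_summable_integral
      (fun t ω => mul_nonneg (hγ t) (sq_nonneg _))
      (fun t => (h.integrable_sq_direction_error t).const_mul (γ t)) ?_)
  simpa only [integral_const_mul] using sum_error

theorem exists_inner_gradient_le : ∃ A : ℝ, 0 ≤ A ∧ ∀ t ω, ∀ y ∈ K,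
    ⟪G (x t ω), x t ω - y⟫ ≤ A * (‖xbar t ω - x t ω‖ + ‖f (t + 1) ω - G (x t ω)‖) := by
  obtain ⟨C, hC⟩ := h.isCompact.exists_bound_of_continuousOn h.lipschitz.continuousOn
  have hR : 0 ≤ Metric.diam K := Metric.diam_nonneg
  refine ⟨D * Metric.diam K + Metric.diam K + |C|,
    by have := h.D_nonneg; positivity, fun t ω y hy => ?_⟩
  have split : ⟪G (x t ω), x t ω - y⟫ = ⟪f (t + 1) ω, xbar t ω - y⟫
      - ⟪f (t + 1) ω - G (x t ω), xbar t ω - y⟫ - ⟪G (x t ω), xbar t ω - x t ω⟫ := by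
    simp only [inner_sub_left, inner_sub_right]; ring
  have hdiam := h.dist_le_diam (h.mem_bar t ω) hy
  have projection_part : ⟪f (t + 1) ω, xbar t ω - y⟫
      ≤ D * Metric.diam K * ‖xbar t ω - x t ω‖ := by
    rw [mul_right_comm]
    exact (h.optimality t ω y hy).trans (mul_le_mul_of_nonneg_left hdiam
      (mul_nonneg h.D_nonneg (norm_nonneg _)))
  have error_part : -⟪f (t + 1) ω - G (x t ω), xbar t ω - y⟫
      ≤ Metric.diam K * ‖f (t + 1) ω - G (x t ω)‖ := by
    rw [mul_comm]
    exact (neg_le_abs _).trans ((abs_real_inner_le_norm _ _).trans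
      (mul_le_mul_of_nonneg_left hdiam (norm_nonneg _)))
  have step_part : -⟪G (x t ω), xbar t ω - x t ω⟫ ≤ |C| * ‖xbar t ω - x t ω‖ :=
    (neg_le_abs _).trans ((abs_real_inner_le_norm _ _).trans
      (mul_le_mul_of_nonneg_right ((hC _ (h.mem t ω)).trans (le_abs_self C)) (norm_nonneg _)))
  have := norm_nonneg (xbar t ω - x t ω)
  have := norm_nonneg (f (t + 1) ω - G (x t ω))
  have := h.D_nonneg
  calc ⟪G (x t ω), x t ω - y⟫
      ≤ (D * Metric.diam K + |C|) * ‖xbar t ω - x t ω‖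
        + Metric.diam K * ‖f (t + 1) ω - G (x t ω)‖ := by linarith
    _ ≤ (D * Metric.diam K + Metric.diam K + |C|)
        * (‖xbar t ω - x t ω‖ + ‖f (t + 1) ω - G (x t ω)‖) := by
      rw [mul_add]
      gcongr
      · linarith
      · exact le_add_of_le_of_nonneg (le_add_of_nonneg_left (by positivity)) (abs_nonneg C)

theorem exists_abs_gap_sub_le {y : E} (hy : y ∈ K) : ∃ A : ℝ, 0 ≤ A ∧ ∀ u ∈ K, ∀ v ∈ K,
    |⟪G u, u - y⟫ - ⟪G v, v - y⟫| ≤ A * ‖u - v‖ := by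
  obtain ⟨C, hC⟩ := h.isCompact.exists_bound_of_continuousOn h.lipschitz.continuousOn
  refine ⟨ℓ * Metric.diam K + |C|,
    add_nonneg (mul_nonneg ℓ.2 Metric.diam_nonneg) (abs_nonneg C), fun u hu v hv => ?_⟩
  rw [show ⟪G u, u - y⟫ - ⟪G v, v - y⟫ = ⟪G u - G v, u - y⟫ + ⟪G v, u - v⟫ by
    simp only [inner_sub_left, inner_sub_right]; ring]
  have gradient_part : |⟪G u - G v, u - y⟫| ≤ ℓ * ‖u - v‖ * Metric.diam K :=
    (abs_real_inner_le_norm _ _).trans (mul_le_mul (h.lipschitz.norm_sub_le hu hv)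
      (h.dist_le_diam hu hy) (norm_nonneg _) (mul_nonneg ℓ.2 (norm_nonneg _)))
  have point_part : |⟪G v, u - v⟫| ≤ |C| * ‖u - v‖ :=
    (abs_real_inner_le_norm _ _).trans
      (mul_le_mul_of_nonneg_right ((hC v hv).trans (le_abs_self C)) (norm_nonneg _))
  linarith [abs_add_le ⟪G u - G v, u - y⟫ ⟪G v, u - v⟫]

theorem tendsto_posPart_gap (hst : StepRules ρ γ) {ω : Ω}
    (hstep : Summable fun t => γ t * ‖xbar t ω - x t ω‖ ^ 2)
    (herr : Summable fun t => γ t * ‖f (t + 1) ω - G (x t ω)‖ ^ 2) {y : E} (hy : y ∈ K) :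
    Tendsto (fun t => max ⟪G (x t ω), x t ω - y⟫ 0) atTop (𝓝 0) := by
  obtain ⟨A, hA0, hA⟩ := h.exists_inner_gradient_le
  obtain ⟨B, hB0, hB⟩ := h.exists_abs_gap_sub_le hy
  refine tendsto_zero_of_summable_mul_sq (C := B * Metric.diam K) hst.gamma_mem hst.gamma_sum
    hst.gamma_sq_summable (fun t => le_max_right _ _) (fun t => ?_) ?_
  · have hγ := (hst.gamma_mem t).1
    calc |max ⟪G (x t ω), x t ω - y⟫ 0 - max ⟪G (x (t + 1) ω), x (t + 1) ω - y⟫ 0|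
        ≤ |⟪G (x t ω), x t ω - y⟫ - ⟪G (x (t + 1) ω), x (t + 1) ω - y⟫| :=
          abs_max_sub_max_le_abs _ _ _
      _ ≤ B * ‖x t ω - x (t + 1) ω‖ := hB _ (h.mem t ω) _ (h.mem (t + 1) ω)
      _ = B * ‖xbar t ω - x t ω‖ * γ t := by
        rw [norm_sub_rev, h.x_succ_sub, norm_smul, Real.norm_of_nonneg hγ]; ring
      _ ≤ B * Metric.diam K * γ t := by
        gcongr
        exact h.dist_le_diam (h.mem_bar t ω) (h.mem t ω)
  · refine ((hstep.add herr).mul_left (2 * A ^ 2)).of_nonneg_of_le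
      (fun t => mul_nonneg (hst.gamma_mem t).1 (sq_nonneg _)) fun t => ?_
    have hgap : max ⟪G (x t ω), x t ω - y⟫ 0
        ≤ A * (‖xbar t ω - x t ω‖ + ‖f (t + 1) ω - G (x t ω)‖) :=
      max_le (hA t ω y hy) (by positivity)
    calc γ t * max ⟪G (x t ω), x t ω - y⟫ 0 ^ 2
        ≤ γ t * (A ^ 2 * (2 * (‖xbar t ω - x t ω‖ ^ 2 + ‖f (t + 1) ω - G (x t ω)‖ ^ 2))) := by
          refine mul_le_mul_of_nonneg_left ?_ (hst.gamma_mem t).1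
          refine (pow_le_pow_left₀ (le_max_right _ _) hgap 2).trans ?_
          rw [mul_pow]
          exact mul_le_mul_of_nonneg_left add_sq_le (sq_nonneg A)
      _ = 2 * A ^ 2 * (γ t * ‖xbar t ω - x t ω‖ ^ 2
            + γ t * ‖f (t + 1) ω - G (x t ω)‖ ^ 2) := by ring

theorem inner_gradient_nonneg_of_mapClusterPt {ω : Ω} {y z : E} (hz : z ∈ K)
    (hlim : Tendsto (fun t => max ⟪G (x t ω), x t ω - y⟫ 0) atTop (𝓝 0))
    (hcl : MapClusterPt z atTop fun t => x t ω) : 0 ≤ ⟪G z, y - z⟫ := by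
  have hcont : ContinuousOn (fun u => ⟪G u, u - y⟫) K :=
    h.lipschitz.continuousOn.inner (continuousOn_id.sub continuousOn_const)
  obtain ⟨U, hU, hxz⟩ := mapClusterPt_iff_ultrafilter.1 hcl
  have hxz' : Tendsto (fun t => x t ω) U (𝓝[K] z) :=
    tendsto_nhdsWithin_iff.2 ⟨hxz, Eventually.of_forall fun t => h.mem t ω⟩
  have gap_nonpos : ⟪G z, z - y⟫ ≤ 0 :=
    le_of_tendsto_of_tendsto' ((hcont z hz).tendsto.comp hxz') (hlim.mono_left hU)
      fun t => le_max_left _ _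
  rwa [← neg_sub, inner_neg_right, neg_nonneg]

theorem ae_forall_mapClusterPt [IsFiniteMeasure μ] (hst : StepRules ρ γ) :
    ∀ᵐ ω ∂μ, ∀ z ∈ K, MapClusterPt z atTop (fun t => x t ω) → ∀ y ∈ K, 0 ≤ ⟪G z, y - z⟫ := by
  filter_upwards [h.ae_summable hst] with ω ⟨hstep, herr⟩ z hz hcl y hy
  exact h.inner_gradient_nonneg_of_mapClusterPt hz (h.tendsto_posPart_gap hst hstep herr hy) hcl

end AveragedGradientRun

end AveragedGradientMethod

section ConditionalLaw

open ProbabilityTheory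

theorem condDistrib_ae_eq_of_condExp_indicator_ae_eq {Ω T Θ : Type*} {mΩ : MeasurableSpace Ω}
    {mT : MeasurableSpace T} [MeasurableSpace Θ] [StandardBorelSpace Θ] [Nonempty Θ]
    {μ : Measure Ω} [IsFiniteMeasure μ] {κ : Kernel T Θ} [IsMarkovKernel κ] {Y : Ω → T}
    {θ : Ω → Θ} (hY : Measurable Y) (hθ : Measurable θ)
    (hlaw : ∀ A, MeasurableSet A → μ[(θ ⁻¹' A).indicator (fun _ => (1 : ℝ)) | mT.comap Y] =ᵐ[μ]
      fun ω => (κ (Y ω)).real A) :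
    condDistrib θ Y μ =ᵐ[μ.map Y] κ := by
  have slice : ∀ A, MeasurableSet A →
      (fun y => condDistrib θ Y μ y A) =ᵐ[μ.map Y] fun y => κ y A := fun A hA => by
    refine (ae_map_iff hY.aemeasurable
      (measurableSet_eq_fun (Kernel.measurable_coe _ hA) (Kernel.measurable_coe _ hA))).2 ?_
    filter_upwards [condDistrib_ae_eq_condExp hY hθ hA (μ := μ), hlaw A hA] with ω h₁ h₂
    exact (measureReal_eq_measureReal_iff).1 (h₁.trans h₂)
  refine condDistrib_ae_eq_of_measure_eq_compProd Y hθ.aemeasurable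
    (Measure.ext_prod fun {D A} hD hA => ?_)
  rw [← compProd_map_condDistrib hθ.aemeasurable, Measure.compProd_apply_prod hD hA,
    Measure.compProd_apply_prod hD hA]
  exact lintegral_congr_ae (ae_restrict_of_ae (slice A hA))

theorem condExp_comp_ae_eq_integral_kernel {Ω T S Θ F : Type*} {mΩ : MeasurableSpace Ω}
    {mT : MeasurableSpace T} [MeasurableSpace S] [MeasurableSpace Θ] [StandardBorelSpace Θ]
    [Nonempty Θ] [NormedAddCommGroup F] [NormedSpace ℝ F] [CompleteSpace F] {μ : Measure Ω}
    [IsFiniteMeasure μ] {κ : Kernel T Θ} [IsMarkovKernel κ] {Y : Ω → T} {θ : Ω → Θ}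
    (hY : Measurable Y) (hθ : Measurable θ)
    (hlaw : ∀ A, MeasurableSet A → μ[(θ ⁻¹' A).indicator (fun _ => (1 : ℝ)) | mT.comap Y] =ᵐ[μ]
      fun ω => (κ (Y ω)).real A)
    {X : T → S} (hX : Measurable X) {g : S × Θ → F}
    (hg : AEStronglyMeasurable g (μ.map fun ω => (X (Y ω), θ ω)))
    (hgi : Integrable (fun ω => g (X (Y ω), θ ω)) μ) :
    μ[fun ω => g (X (Y ω), θ ω) | mT.comap Y] =ᵐ[μ] fun ω => ∫ s, g (X (Y ω), s) ∂κ (Y ω) := by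
  have hXθ : Measurable fun z : T × Θ => (X z.1, z.2) :=
    (hX.comp measurable_fst).prodMk measurable_snd
  have hg' : AEStronglyMeasurable (fun z : T × Θ => g (X z.1, z.2))
      (μ.map fun ω => (Y ω, θ ω)) := by
    refine AEStronglyMeasurable.comp_measurable ?_ hXθ
    rwa [Measure.map_map hXθ (hY.prodMk hθ)]
  filter_upwards [condExp_prod_ae_eq_integral_condDistrib₀ hY hθ.aemeasurable hg' hgi,
    ae_of_ae_map hY.aemeasurable (condDistrib_ae_eq_of_condExp_indicator_ae_eq hY hθ hlaw)]
    with ω cond law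
  rw [cond, law]

-- `m` is generated by the identity `(Ω, mΩ) → (Ω, m)`, and `κ` is a kernel on `(Ω, m)`.
theorem condExp_comp_ae_eq_integral {Ω S Θ F : Type*}
    {m mΩ : MeasurableSpace Ω} (hm : m ≤ mΩ) [MeasurableSpace S] [MeasurableSpace Θ]
    [StandardBorelSpace Θ] [Nonempty Θ] [NormedAddCommGroup F] [NormedSpace ℝ F] [CompleteSpace F]
    {μ : Measure Ω} [IsFiniteMeasure μ] {κ : Ω → Measure Θ} (hκ : Measurable[m] κ)
    (hκ1 : ∀ ω, IsProbabilityMeasure (κ ω)) {X : Ω → S} (hX : Measurable[m] X)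
    {θ : Ω → Θ} (hθ : Measurable θ)
    (hlaw : ∀ A, MeasurableSet A → μ[(θ ⁻¹' A).indicator (fun _ => (1 : ℝ)) | m] =ᵐ[μ]
      fun ω => (κ ω).real A)
    {g : S × Θ → F} (hg : AEStronglyMeasurable g (μ.map fun ω => (X ω, θ ω)))
    (hgi : Integrable (fun ω => g (X ω, θ ω)) μ) :
    μ[fun ω => g (X ω, θ ω) | m] =ᵐ[μ] fun ω => ∫ s, g (X ω, s) ∂κ ω := by
  have cond := @condExp_comp_ae_eq_integral_kernel Ω Ω S Θ F mΩ m _ _ _ _ _ _ _ μ _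
    (@Kernel.mk Ω Θ m _ κ hκ) (@IsMarkovKernel.mk Ω Θ m _ _ hκ1) id θ (measurable_id'' hm) hθ
    (by rwa [MeasurableSpace.comap_id]) X hX g hg hgi
  rwa [MeasurableSpace.comap_id] at cond

theorem measurable_measure_pi {Ω ι : Type*} [Fintype ι] {X : ι → Type*}
    [∀ i, MeasurableSpace (X i)] {m : MeasurableSpace Ω} {κ : ∀ i, Ω → Measure (X i)}
    (hκ : ∀ i, Measurable (κ i)) (hκ1 : ∀ i ω, IsProbabilityMeasure (κ i ω)) :
    Measurable fun ω => Measure.pi fun i => κ i ω := by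
  refine Measurable.measure_of_isPiSystem_of_isProbabilityMeasure generateFrom_pi.symm
    isPiSystem_pi ?_
  rintro _ ⟨s, hs, rfl⟩
  simp only [Measure.pi_pi]
  exact Finset.measurable_fun_prod _ fun i _ =>
    (Measure.measurable_coe (hs i trivial)).comp (hκ i)

theorem ae_mem_of_condExp_indicator_ae_eq_one {Ω : Type*} {m mΩ : MeasurableSpace Ω}
    (hm : m ≤ mΩ) {μ : Measure Ω} [IsProbabilityMeasure μ] {s : Set Ω} (hs : MeasurableSet s)
    (h : μ[s.indicator (fun _ => (1 : ℝ)) | m] =ᵐ[μ] fun _ => 1) : ∀ᵐ ω ∂μ, ω ∈ s := by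
  have measureReal_eq_one : μ.real s = 1 := by
    rw [← integral_indicator_one hs]
    refine (integral_condExp hm).symm.trans ((integral_congr_ae h).trans ?_)
    rw [integral_const, probReal_univ, one_smul]
  rw [Measure.real, ENNReal.toReal_eq_one_iff] at measureReal_eq_one
  exact (prob_compl_eq_zero_iff hs).2 measureReal_eq_one

theorem aestronglyMeasurable_map_of_continuousOn {Ω X F : Type*} [MeasurableSpace Ω]
    {μ : Measure Ω} [TopologicalSpace X] [SecondCountableTopology X] [MeasurableSpace X]
    [OpensMeasurableSpace X] [TopologicalSpace F] [TopologicalSpace.PseudoMetrizableSpace F]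
    {g : X → F} {S : Set X} (hS : MeasurableSet S) (hg : ContinuousOn g S) {Z : Ω → X}
    (hZ : Measurable Z) (hZS : ∀ᵐ ω ∂μ, Z ω ∈ S) : AEStronglyMeasurable g (μ.map Z) := by
  rw [← Measure.restrict_eq_self_of_ae_mem ((ae_map_iff hZ.aemeasurable hS).2 hZS)]
  exact hg.aestronglyMeasurable hS

theorem aestronglyMeasurable_comp_of_map {Ω X F : Type*} {m mΩ : MeasurableSpace Ω} (hm : m ≤ mΩ)
    {μ : Measure Ω} [MeasurableSpace X] [TopologicalSpace F] {g : X → F} {Z : Ω → X}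
    (hZ : Measurable[m] Z) (hg : AEStronglyMeasurable g (μ.map Z)) :
    AEStronglyMeasurable[m] (fun ω => g (Z ω)) μ :=
  ⟨fun ω => hg.mk g (Z ω), hg.stronglyMeasurable_mk.comp_measurable hZ,
    ae_of_ae_map (hZ.mono hm le_rfl).aemeasurable hg.ae_eq_mk⟩

end ConditionalLaw

section LocallyLipschitz

variable {α β γ : Type*} [PseudoEMetricSpace α] [PseudoEMetricSpace β] [PseudoEMetricSpace γ]
  {s : Set α} {f g : α → β}

theorem locallyLipschitzOn_of_lipschitzOnWith {k : ℝ≥0} (hf : LipschitzOnWith k f s) :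
    LocallyLipschitzOn s f :=
  fun _ _ => ⟨k, s, self_mem_nhdsWithin, hf⟩

theorem locallyLipschitzOn_comp {φ : β → γ} {t : Set β} (hφ : LocallyLipschitzOn t φ)
    (hf : LocallyLipschitzOn s f) (hst : Set.MapsTo f s t) : LocallyLipschitzOn s (φ ∘ f) := by
  intro x hx
  obtain ⟨k, u, hu, hfu⟩ := hf hx
  obtain ⟨l, v, hv, hφv⟩ := hφ (hst hx)
  have hfv : f ⁻¹' v ∈ 𝓝[s] x := (hf.continuousOn x hx).tendsto_nhdsWithin hst hv
  exact ⟨l * k, u ∩ f ⁻¹' v, inter_mem hu hfv,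
    hφv.comp (hfu.mono Set.inter_subset_left) fun _ hy => hy.2⟩

theorem locallyLipschitzOn_congr (hf : LocallyLipschitzOn s f) (hfg : Set.EqOn g f s) :
    LocallyLipschitzOn s g := by
  intro x hx
  obtain ⟨k, u, hu, hfu⟩ := hf hx
  refine ⟨k, u ∩ s, inter_mem hu self_mem_nhdsWithin, fun y hy z hz => ?_⟩
  rw [hfg hy.2, hfg hz.2]
  exact hfu hy.1 hz.1

theorem locallyLipschitzOn_prodMk {g : α → γ} (hf : LocallyLipschitzOn s f)
    (hg : LocallyLipschitzOn s g) : LocallyLipschitzOn s fun x => (f x, g x) := by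
  intro x hx
  obtain ⟨k, u, hu, hfu⟩ := hf hx
  obtain ⟨l, v, hv, hgv⟩ := hg hx
  exact ⟨max k l, u ∩ v, inter_mem hu hv,
    (hfu.mono Set.inter_subset_left).prodMk (hgv.mono Set.inter_subset_right)⟩

theorem locallyLipschitzOn_pi {ι : Type*} [Fintype ι] {X : ι → Type*}
    [∀ i, PseudoEMetricSpace (X i)] {f : α → ∀ i, X i}
    (hf : ∀ i, LocallyLipschitzOn s fun x => f x i) : LocallyLipschitzOn s f := by
  intro x hx
  choose k u hu hfu using fun i => hf i hx
  refine ⟨Finset.univ.sup k, ⋂ i, u i, iInter_mem.2 hu, fun y hy z hz => ?_⟩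
  refine edist_pi_le_iff.2 fun i => ?_
  refine (hfu i (Set.mem_iInter.1 hy i) (Set.mem_iInter.1 hz i)).trans ?_
  gcongr
  exact Finset.le_sup (Finset.mem_univ i)

end LocallyLipschitz

section LocallyLipschitzNormed

variable {α E F : Type*} [PseudoEMetricSpace α] [NormedAddCommGroup E] [NormedSpace ℝ E]
  [NormedAddCommGroup F] [NormedSpace ℝ F]

theorem locallyLipschitzOn_contDiff_comp {s : Set α} {f : α → E} {φ : E → F}
    (hφ : ContDiff ℝ 1 φ) (hf : LocallyLipschitzOn s f) :
    LocallyLipschitzOn s fun x => φ (f x) :=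
  locallyLipschitzOn_comp hφ.locallyLipschitz.locallyLipschitzOn hf (Set.mapsTo_univ f s)

theorem locallyLipschitzOn_smul {s : Set α} {a : α → ℝ} {f : α → F}
    (ha : LocallyLipschitzOn s a) (hf : LocallyLipschitzOn s f) :
    LocallyLipschitzOn s fun x => a x • f x :=
  locallyLipschitzOn_contDiff_comp contDiff_smul (locallyLipschitzOn_prodMk ha hf)

theorem locallyLipschitzOn_sum {ι : Type*} [Fintype ι] {s : Set α} {f : ι → α → F}
    (hf : ∀ i, LocallyLipschitzOn s (f i)) : LocallyLipschitzOn s fun x => ∑ i, f i x :=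
  locallyLipschitzOn_contDiff_comp (φ := fun v : ι → F => ∑ i, v i) (by fun_prop)
    (locallyLipschitzOn_pi hf)

theorem locallyLipschitzOn_of_lipschitzGradientOn {f : E → F} {s : Set E} (hs : Convex ℝ s)
    (hf : LipschitzGradientOn f s) : LocallyLipschitzOn s f := by
  obtain ⟨f', k, hf', hk⟩ := hf
  exact fun x hx => hs.exists_nhdsWithin_lipschitzOnWith_of_hasFDerivWithinAt
    (eventually_mem_nhdsWithin.mono hf') (hk.continuousOn x hx)

theorem locallyLipschitzOn_log : LocallyLipschitzOn (Set.Ioi 0) Real.log :=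
  ContDiffOn.locallyLipschitzOn (convex_Ioi 0) fun _ hs =>
    (Real.contDiffAt_log.2 (ne_of_gt hs)).contDiffWithinAt

end LocallyLipschitzNormed

namespace Model

variable {J N Np : ℕ} (M : Model J N)

section SearchRegion

theorem isCompact_interval (j : Fin J) : IsCompact (M.interval j) := isCompact_Icc

theorem convex_interval (j : Fin J) : Convex ℝ (M.interval j) := convex_Icc _ _

theorem box_eq_pi : M.box = Set.univ.pi M.interval := by
  ext θ
  simp only [box, Set.mem_ofPred_eq, Set.mem_univ_pi]

theorem isCompact_box : IsCompact M.box := by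
  rw [box_eq_pi]
  exact isCompact_univ_pi M.isCompact_interval

theorem convex_box : Convex ℝ M.box := by
  rw [box_eq_pi]
  exact convex_pi fun j _ => M.convex_interval j

theorem update_mem_box {θ : Fin J → ℝ} (hθ : θ ∈ M.box) {j : Fin J} {s : ℝ}
    (hs : s ∈ M.interval j) : Function.update θ j s ∈ M.box := by
  rw [box_eq_pi] at hθ ⊢
  exact Set.update_mem_pi_iff_of_mem hθ |>.2 fun _ => hs

theorem posSet_eq_pi (j : Fin J) : M.posSet Np j = Set.univ.pi fun _ => M.interval j := by
  ext v
  simp only [posSet, Set.mem_ofPred_eq, Set.mem_univ_pi]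

theorem convex_posSet (j : Fin J) : Convex ℝ (M.posSet Np j) := by
  rw [posSet_eq_pi]
  exact convex_pi fun _ _ => M.convex_interval j

theorem isCompact_posSet (j : Fin J) : IsCompact (M.posSet Np j) := by
  rw [posSet_eq_pi]
  exact isCompact_univ_pi fun _ => M.isCompact_interval j

theorem weightSet_eq_inter :
    M.weightSet Np = {v | ∑ n, v n = 1} ∩ Set.univ.pi fun _ => Set.Icc M.ε 1 := by
  ext v
  simp only [weightSet, Set.mem_ofPred_eq, Set.mem_inter_iff, Set.mem_univ_pi, Set.mem_Icc]

theorem convex_weightSet : Convex ℝ (M.weightSet Np) := by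
  rw [weightSet_eq_inter]
  exact (convex_hyperplane (f := fun v : Fin Np → ℝ => ∑ n, v n)
    ⟨fun _ _ => Finset.sum_add_distrib, fun _ _ => (Finset.mul_sum ..).symm⟩ 1).inter
    (convex_pi fun _ _ => convex_Icc _ _)

theorem isCompact_weightSet : IsCompact (M.weightSet Np) := by
  rw [weightSet_eq_inter]
  exact (isCompact_univ_pi fun _ => isCompact_Icc).inter_left
    (isClosed_eq (by fun_prop) continuous_const)

theorem feasible_eq_prod : M.feasible Np =
    Set.univ.pi (M.posSet Np) ×ˢ Set.univ.pi fun _ => M.weightSet Np := by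
  ext x
  simp only [feasible, Set.mem_ofPred_eq, Set.mem_prod, Set.mem_univ_pi, forall_and]

theorem convex_feasible : Convex ℝ (M.feasible Np) := by
  rw [feasible_eq_prod]
  exact (convex_pi fun j _ => M.convex_posSet j).prod (convex_pi fun _ _ => M.convex_weightSet)

theorem isCompact_feasible : IsCompact (M.feasible Np) := by
  rw [feasible_eq_prod]
  exact (isCompact_univ_pi M.isCompact_posSet).prod
    (isCompact_univ_pi fun _ => M.isCompact_weightSet)

end SearchRegion

section Score

/-- The `j`-th partial derivative of the log-likelihood plus the log-prior of the `j`-th unknown,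
taken within the search interval. -/
noncomputable def score (j : Fin J) (θ : Fin J → ℝ) : ℝ :=
  derivWithin (fun s => Real.log (M.prior j s) + Real.log (M.lik (Function.update θ j s)))
    (M.interval j) (θ j)

theorem gradP_eq (p w : Particles J Np) (θ : Fin J → ℝ) (j : Fin J) (n : Fin Np) :
    M.gradP p w θ j n = -(w j n) * M.score j (Function.update θ j (p j n)) := by
  simp only [gradP, score, Function.update_idem, Function.update_self]

theorem subsingleton_interval {j : Fin J} (hj : M.width j ≤ 0) :
    (M.interval j).Subsingleton :=
  Set.subsingleton_Icc_of_ge (by linarith)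

theorem score_eq_zero {j : Fin J} (hj : M.width j ≤ 0) (θ : Fin J → ℝ) : M.score j θ = 0 :=
  derivWithin_zero_of_not_accPt fun h =>
    Set.Infinite.of_accPt h (M.subsingleton_interval hj).finite

theorem score_eq {j : Fin J} (hj : 0 < M.width j) {θ : Fin J → ℝ} (hθ : θ ∈ M.box)
    {a' : ℝ →L[ℝ] ℝ}
    (ha : HasFDerivWithinAt (fun s => Real.log (M.prior j s)) a' (M.interval j) (θ j))
    {l' : (Fin J → ℝ) →L[ℝ] ℝ} (hl : HasFDerivWithinAt (fun θ => Real.log (M.lik θ)) l' M.box θ) :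
    M.score j θ = a' 1 + l' (Pi.single j 1) := by
  have update_deriv : HasDerivWithinAt (Function.update θ j) (Pi.single j (1 : ℝ))
      (M.interval j) (θ j) := (hasDerivAt_update θ j (θ j)).hasDerivWithinAt
  have lik_deriv : HasDerivWithinAt (fun s => Real.log (M.lik (Function.update θ j s)))
      (l' (Pi.single j 1)) (M.interval j) (θ j) := by
    rw [← Function.update_eq_self j θ] at hl
    exact hl.comp_hasDerivWithinAt (θ j) update_deriv fun s hs => M.update_mem_box hθ hs
  exact (ha.hasDerivWithinAt.add lik_deriv).derivWithin
    (uniqueDiffOn_Icc (by linarith) _ (hθ j))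

variable {M} in
theorem Regular.locallyLipschitzOn_score (hM : M.Regular) (j : Fin J) :
    LocallyLipschitzOn M.box (M.score j) := by
  rcases le_or_gt (M.width j) 0 with hj | hj
  · exact locallyLipschitzOn_congr (LipschitzWith.const (0 : ℝ)).locallyLipschitz.locallyLipschitzOn
      fun θ _ => M.score_eq_zero hj θ
  obtain ⟨a', k, ha, hk⟩ := hM.log_prior j
  obtain ⟨l', k', hl, hk'⟩ := hM.log_lik
  have prior_part : LocallyLipschitzOn M.box fun θ => a' (θ j) 1 :=
    locallyLipschitzOn_contDiff_comp (φ := fun A : ℝ →L[ℝ] ℝ => A 1) (by fun_prop)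
      (locallyLipschitzOn_comp (locallyLipschitzOn_of_lipschitzOnWith hk)
        (LipschitzWith.eval j).locallyLipschitz.locallyLipschitzOn fun θ hθ => hθ j)
  have lik_part : LocallyLipschitzOn M.box fun θ => l' θ (Pi.single j 1) :=
    locallyLipschitzOn_contDiff_comp (φ := fun A : (Fin J → ℝ) →L[ℝ] ℝ => A (Pi.single j 1))
      (by fun_prop) (locallyLipschitzOn_of_lipschitzOnWith hk')
  exact locallyLipschitzOn_congr (prior_part.add lik_part) fun θ hθ =>
    M.score_eq hj hθ (ha _ (hθ j)) (hl θ hθ)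

end Score

end Model

/-- Positions and weights of all particles. -/
abbrev Config (J Np : ℕ) : Type := Particles J Np × Particles J Np

section ParticleMean

variable {J Np : ℕ} {F : Type*} [AddCommGroup F] [Module ℝ F]

/-- The mass of the joint particle selected by `ν`. -/
def jointWeight (w : Particles J Np) (ν : Fin J → Fin Np) : ℝ := ∏ j, w j (ν j)

/-- The position of the joint particle selected by `ν`. -/
def jointParticle (p : Particles J Np) (ν : Fin J → Fin Np) : Fin J → ℝ := fun j => p j (ν j)

/-- The mean of `φ` under the particle distribution `∏ j, ∑ n, w j n • δ (p j n)`. -/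
noncomputable def particleMean (p w : Particles J Np) (φ : (Fin J → ℝ) → F) : F :=
  ∑ ν, jointWeight w ν • φ (jointParticle p ν)

theorem sum_jointWeight {w : Particles J Np} (hw : ∀ j, ∑ n, w j n = 1) :
    ∑ ν, jointWeight w ν = 1 := by
  simp only [jointWeight, ← Fintype.prod_sum, hw, Finset.prod_const_one]

theorem jointWeight_eq_mul_prod_erase (w : Particles J Np) (ν : Fin J → Fin Np) (j : Fin J) :
    jointWeight w ν = w j (ν j) * ∏ i ∈ Finset.univ.erase j, w i (ν i) :=
  (Finset.mul_prod_erase _ _ (Finset.mem_univ j)).symm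

theorem jointParticle_update (p : Particles J Np) (ν : Fin J → Fin Np) (j : Fin J) (n : Fin Np) :
    jointParticle p (Function.update ν j n) = Function.update (jointParticle p ν) j (p j n) := by
  ext i
  exact Function.apply_update (fun i => p i) ν j n i

-- Swapping the `j`-th index of `ν` with an independent copy distributed according to `w j`.
theorem sum_prod_erase_mul {w : Particles J Np} {j : Fin J} (hw : ∑ n, w j n = 1)
    (H : (Fin J → Fin Np) → ℝ) :
    ∑ ν : Fin J → Fin Np, (∏ i ∈ Finset.univ.erase j, w i (ν i)) * H ν
      = ∑ n, ∑ ν, jointWeight w ν * H (Function.update ν j n) := by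
  have erase_update : ∀ (ν : Fin J → Fin Np) n,
      ∏ i ∈ Finset.univ.erase j, w i (Function.update ν j n i)
        = ∏ i ∈ Finset.univ.erase j, w i (ν i) := fun ν n =>
    Finset.prod_congr rfl fun i hi => by rw [Function.update_of_ne (Finset.ne_of_mem_erase hi)]
  have swap_involutive : Function.Involutive fun z : Fin Np × (Fin J → Fin Np) =>
      (z.2 j, Function.update z.2 j z.1) := fun z => by
    simp only [Function.update_self, Function.update_idem, Function.update_eq_self]
  calc ∑ ν : Fin J → Fin Np, (∏ i ∈ Finset.univ.erase j, w i (ν i)) * H ν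
      = ∑ n, ∑ ν : Fin J → Fin Np, w j n * ((∏ i ∈ Finset.univ.erase j, w i (ν i)) * H ν) := by
        simp only [← Finset.mul_sum, ← Finset.sum_mul, hw, one_mul]
    _ = ∑ z : Fin Np × (Fin J → Fin Np),
          w j z.1 * ((∏ i ∈ Finset.univ.erase j, w i (z.2 i)) * H z.2) :=
        (Fintype.sum_prod_type' _).symm
    _ = ∑ z : Fin Np × (Fin J → Fin Np), jointWeight w z.2 * H (Function.update z.2 j z.1) := by
        refine Fintype.sum_equiv swap_involutive.toPerm _ _ fun z => ?_
        simp only [Function.Involutive.coe_toPerm, Function.update_idem, Function.update_eq_self,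
          jointWeight_eq_mul_prod_erase w _ j, erase_update, Function.update_self]
        ring
    _ = ∑ n, ∑ ν, jointWeight w ν * H (Function.update ν j n) :=
        Fintype.sum_prod_type' fun n ν => jointWeight w ν * H (Function.update ν j n)

theorem sum_jointWeight_mul_apply {w : Particles J Np} (hw : ∀ j, ∑ n, w j n = 1) (j : Fin J)
    (a : Fin Np → ℝ) : ∑ ν, jointWeight w ν * a (ν j) = ∑ n, w j n * a n := by
  calc ∑ ν, jointWeight w ν * a (ν j)
      = ∑ ν : Fin J → Fin Np, (∏ i ∈ Finset.univ.erase j, w i (ν i)) * (w j (ν j) * a (ν j)) :=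
        Finset.sum_congr rfl fun ν _ => by rw [jointWeight_eq_mul_prod_erase w ν j]; ring
    _ = ∑ n, ∑ ν, jointWeight w ν * (w j n * a n) := by
        simp only [sum_prod_erase_mul (hw j), Function.update_self]
    _ = ∑ n, w j n * a n := by
        simp only [← Finset.sum_mul, sum_jointWeight hw, one_mul]

theorem map_particleMean {G : Type*} [AddCommGroup G] [Module ℝ G] (A : F →ₗ[ℝ] G)
    (p w : Particles J Np) (φ : (Fin J → ℝ) → F) :
    A (particleMean p w φ) = particleMean p w fun θ => A (φ θ) := by
  simp only [particleMean, map_sum, map_smul]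

theorem particleMean_const {w : Particles J Np} (hw : ∀ j, ∑ n, w j n = 1) (p : Particles J Np)
    (c : F) : particleMean p w (fun _ => c) = c := by
  rw [particleMean, ← Finset.sum_smul, sum_jointWeight hw, one_smul]

theorem particleMean_add (p w : Particles J Np) (φ ψ : (Fin J → ℝ) → F) :
    particleMean p w (fun θ => φ θ + ψ θ) = particleMean p w φ + particleMean p w ψ := by
  simp only [particleMean, smul_add, Finset.sum_add_distrib]

theorem particleMean_sub (p w : Particles J Np) (φ ψ : (Fin J → ℝ) → F) :
    particleMean p w (fun θ => φ θ - ψ θ) = particleMean p w φ - particleMean p w ψ := by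
  simp only [particleMean, smul_sub, Finset.sum_sub_distrib]

theorem particleMean_congr {p : Particles J Np} {S : Set (Fin J → ℝ)}
    (hp : ∀ ν, jointParticle p ν ∈ S) (w : Particles J Np) {φ ψ : (Fin J → ℝ) → F}
    (h : Set.EqOn φ ψ S) : particleMean p w φ = particleMean p w ψ :=
  Finset.sum_congr rfl fun ν _ => by rw [h (hp ν)]

end ParticleMean

section Pairing

open scoped RealInnerProductSpace

variable {J Np : ℕ}

/-- The Euclidean space of all positions and weights. -/
abbrev FlatConfig (J Np : ℕ) : Type :=
  EuclideanSpace ℝ ((Fin J × Fin Np) ⊕ (Fin J × Fin Np))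

/-- Positions and weights as one vector of a Euclidean space. -/
noncomputable def flatten (J Np : ℕ) :
    Config J Np ≃L[ℝ] FlatConfig J Np :=
  LinearEquiv.toContinuousLinearEquiv
    { toFun := fun x => WithLp.toLp 2 (Sum.elim (fun a => x.1 a.1 a.2) fun a => x.2 a.1 a.2)
      invFun := fun v => (fun j n => v (Sum.inl (j, n)), fun j n => v (Sum.inr (j, n)))
      map_add' := fun x y => by ext (a | a) <;> rfl
      map_smul' := fun r x => by ext (a | a) <;> rfl
      left_inv := fun x => rfl
      right_inv := fun v => by ext (a | a) <;> rfl }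

theorem inner_flatten (x y : Config J Np) : ⟪flatten J Np x, flatten J Np y⟫
    = ∑ j, ∑ n, (x.1 j n * y.1 j n + x.2 j n * y.2 j n) := by
  rw [PiLp.inner_apply, Fintype.sum_sum_type, ← Finset.sum_add_distrib, Fintype.sum_prod_type]
  exact Finset.sum_congr rfl fun j _ => Finset.sum_congr rfl fun n _ =>
    congrArg₂ (· + ·) (mul_comm _ _) (mul_comm _ _)

/-- The functional `v ↦ ⟪g, v⟫` of the Euclidean inner product on positions and weights. -/
noncomputable def pairing (g : Config J Np) : Config J Np →L[ℝ] ℝ :=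
  innerSL ℝ (flatten J Np g) ∘L (flatten J Np).toContinuousLinearMap

theorem pairing_apply (g v : Config J Np) :
    pairing g v = ∑ j, ∑ n, (g.1 j n * v.1 j n + g.2 j n * v.2 j n) :=
  inner_flatten g v

theorem pairing_sub (g g' : Config J Np) : pairing (g - g') = pairing g - pairing g' := by
  simp only [pairing, map_sub, ContinuousLinearMap.sub_comp]

/-- The coordinate functional of the position `p j n`. -/
noncomputable def posCoord (j : Fin J) (n : Fin Np) : Config J Np →L[ℝ] ℝ :=
  .proj n ∘L .proj j ∘L .fst ℝ (Particles J Np) (Particles J Np)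

/-- The coordinate functional of the weight `w j n`. -/
noncomputable def weightCoord (j : Fin J) (n : Fin Np) : Config J Np →L[ℝ] ℝ :=
  .proj n ∘L .proj j ∘L .snd ℝ (Particles J Np) (Particles J Np)

theorem posCoord_apply (j : Fin J) (n : Fin Np) (x : Config J Np) : posCoord j n x = x.1 j n := rfl

theorem weightCoord_apply (j : Fin J) (n : Fin Np) (x : Config J Np) :
    weightCoord j n x = x.2 j n := rfl

end Pairing

section Derivatives

theorem hasFDerivWithinAt_congr_directions {E F : Type*} [NormedAddCommGroup E]
    [NormedSpace ℝ E] [NormedAddCommGroup F] [NormedSpace ℝ F] {f : E → F} {D D' : E →L[ℝ] F}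
    {s : Set E} {x : E} (h : HasFDerivWithinAt f D s x) (hD : ∀ y ∈ s, D (y - x) = D' (y - x)) :
    HasFDerivWithinAt f D' s x := by
  rw [hasFDerivWithinAt_iff_isLittleO] at h ⊢
  refine h.congr' ?_ EventuallyEq.rfl
  filter_upwards [self_mem_nhdsWithin] with y hy
  rw [hD y hy]

variable {J Np : ℕ} {x : Config J Np} {s : Set (Config J Np)}

theorem sum_jointWeight_mul_add_eq_pairing (hw : ∀ j, ∑ n, x.2 j n = 1)
    (φ : (Fin J → ℝ) → ℝ) (φ' : (Fin J → ℝ) → (Fin J → ℝ) →L[ℝ] ℝ) (v : Config J Np) :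
    ∑ ν, (jointWeight x.2 ν * φ' (jointParticle x.1 ν) (jointParticle v.1 ν)
        + φ (jointParticle x.1 ν) *
          ∑ j, (∏ i ∈ Finset.univ.erase j, x.2 i (ν i)) * v.2 j (ν j))
      = pairing
        (fun j n => x.2 j n * particleMean x.1 x.2
          fun θ => φ' (Function.update θ j (x.1 j n)) (Pi.single j 1),
        fun j n => particleMean x.1 x.2 fun θ => φ (Function.update θ j (x.1 j n))) v := by
  have expand : ∀ ν : Fin J → Fin Np,
      φ' (jointParticle x.1 ν) (jointParticle v.1 ν)
        = ∑ j, v.1 j (ν j) * φ' (jointParticle x.1 ν) (Pi.single j 1) := fun ν => by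
    conv_lhs => rw [pi_eq_sum_univ' (jointParticle v.1 ν), map_sum]
    exact Finset.sum_congr rfl fun j _ => map_smul _ _ _
  calc _ = ∑ j, ∑ ν : Fin J → Fin Np, (∏ i ∈ Finset.univ.erase j, x.2 i (ν i)) *
        (x.2 j (ν j) * (v.1 j (ν j) * φ' (jointParticle x.1 ν) (Pi.single j 1))
          + v.2 j (ν j) * φ (jointParticle x.1 ν)) := by
        rw [Finset.sum_comm]
        refine Finset.sum_congr rfl fun ν _ => ?_
        rw [expand, Finset.mul_sum, Finset.mul_sum, ← Finset.sum_add_distrib]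
        exact Finset.sum_congr rfl fun j _ => by rw [jointWeight_eq_mul_prod_erase x.2 ν j]; ring
    _ = _ := by
        simp only [sum_prod_erase_mul (hw _), Function.update_self, jointParticle_update,
          pairing_apply, particleMean, smul_eq_mul, Finset.mul_sum, Finset.sum_mul,
          ← Finset.sum_add_distrib]
        refine Finset.sum_congr rfl fun j _ => Finset.sum_congr rfl fun n _ =>
          Finset.sum_congr rfl fun ν _ => ?_
        ring

theorem hasFDerivWithinAt_particleMean {S : Set (Fin J → ℝ)} {φ : (Fin J → ℝ) → ℝ}
    {φ' : (Fin J → ℝ) → (Fin J → ℝ) →L[ℝ] ℝ} (hw : ∀ j, ∑ n, x.2 j n = 1)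
    (hs : ∀ y ∈ s, ∀ ν, jointParticle y.1 ν ∈ S) (hx : x ∈ s)
    (hφ : ∀ θ ∈ S, HasFDerivWithinAt φ (φ' θ) S θ) :
    HasFDerivWithinAt (fun y : Config J Np => particleMean y.1 y.2 φ)
      (pairing
        (fun j n => x.2 j n * particleMean x.1 x.2
          fun θ => φ' (Function.update θ j (x.1 j n)) (Pi.single j 1),
        fun j n => particleMean x.1 x.2 fun θ => φ (Function.update θ j (x.1 j n)))) s x := by
  have weight : ∀ ν : Fin J → Fin Np, HasFDerivWithinAt (fun y : Config J Np => jointWeight y.2 ν)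
      (∑ j, (∏ i ∈ Finset.univ.erase j, x.2 i (ν i)) • weightCoord j (ν j)) s x := fun ν =>
    HasFDerivWithinAt.finsetProd fun j _ => (weightCoord j (ν j)).hasFDerivWithinAt
  have value : ∀ ν : Fin J → Fin Np,
      HasFDerivWithinAt (fun y : Config J Np => φ (jointParticle y.1 ν))
        (φ' (jointParticle x.1 ν) ∘L .pi fun j => posCoord j (ν j)) s x := fun ν =>
    (hφ _ (hs x hx ν)).comp x (ContinuousLinearMap.pi fun j => posCoord j (ν j)).hasFDerivWithinAt
      fun y hy => hs y hy ν
  refine (HasFDerivWithinAt.fun_sum (u := Finset.univ) fun ν _ =>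
    (weight ν).mul (value ν)).congr_fderiv (ContinuousLinearMap.ext fun v => ?_)
  rw [← sum_jointWeight_mul_add_eq_pairing hw]
  simp only [_root_.sum_apply, _root_.add_apply, _root_.smul_apply, smul_eq_mul,
    ContinuousLinearMap.comp_apply, weightCoord_apply]
  rfl

theorem hasFDerivWithinAt_sum_mul_log_sub {a : Fin J → ℝ → ℝ} {a' : Fin J → Fin Np → ℝ}
    {I : Fin J → Set ℝ} (hs : ∀ y ∈ s, ∀ j n, y.1 j n ∈ I j) (hx : ∀ j n, x.2 j n ≠ 0)
    (ha : ∀ j n, HasDerivWithinAt (a j) (a' j n) (I j) (x.1 j n)) :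
    HasFDerivWithinAt
      (fun y : Config J Np => ∑ j, ∑ n, y.2 j n * (Real.log (y.2 j n) - a j (y.1 j n)))
      (pairing (fun j n => -(x.2 j n * a' j n),
        fun j n => Real.log (x.2 j n) + 1 - a j (x.1 j n))) s x := by
  have weight : ∀ j n, HasFDerivWithinAt (fun y : Config J Np => y.2 j n) (weightCoord j n) s x :=
    fun j n => (weightCoord j n).hasFDerivWithinAt
  have value : ∀ j n, HasFDerivWithinAt (fun y : Config J Np => a j (y.1 j n))
      (a' j n • posCoord j n) s x := fun j n =>
    (ha j n).comp_hasFDerivWithinAt x (posCoord j n).hasFDerivWithinAt fun y hy => hs y hy j n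
  refine (HasFDerivWithinAt.fun_sum (u := Finset.univ) fun j _ =>
    HasFDerivWithinAt.fun_sum (u := Finset.univ) fun n _ =>
      (weight j n).mul (((weight j n).log (hx j n)).fun_sub (value j n))).congr_fderiv
    (ContinuousLinearMap.ext fun v => ?_)
  simp only [_root_.sum_apply, _root_.add_apply, _root_.sub_apply, _root_.smul_apply, smul_eq_mul,
    weightCoord_apply, posCoord_apply, pairing_apply]
  refine Finset.sum_congr rfl fun j _ => Finset.sum_congr rfl fun n _ => ?_
  have weight_ne := hx j n
  field_simp
  ring

end Derivatives

namespace Model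

variable {J N Np : ℕ} (M : Model J N)

/-- The instantaneous gradients with respect to all positions and weights at the sample `θ`. -/
noncomputable def sampleGrad (x : Config J Np) (θ : Fin J → ℝ) : Config J Np :=
  (M.gradP x.1 x.2 θ, M.gradW x.1 x.2 θ)

/-- The mean of the instantaneous gradients under the particle distribution; within the feasible
set it is the gradient of the objective. -/
noncomputable def meanGrad (x : Config J Np) : Config J Np :=
  particleMean x.1 x.2 (M.sampleGrad x)

theorem meanGrad_fst_apply (x : Config J Np) (j : Fin J) (n : Fin Np) :
    (M.meanGrad x).1 j n = -(x.2 j n) *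
      particleMean x.1 x.2 fun θ => M.score j (Function.update θ j (x.1 j n)) := by
  refine (map_particleMean (posCoord j n).toLinearMap x.1 x.2 (M.sampleGrad x)).trans ?_
  simp only [ContinuousLinearMap.coe_coe, posCoord_apply, sampleGrad, gradP_eq]
  exact (map_particleMean (LinearMap.mulLeft ℝ (-(x.2 j n))) x.1 x.2 _).symm

variable {M} {x : Config J Np}

theorem meanGrad_snd_apply (hw : ∀ j, ∑ n, x.2 j n = 1) (j : Fin J) (n : Fin Np) :
    (M.meanGrad x).2 j n = Real.log (x.2 j n) + 1 - Real.log (M.prior j (x.1 j n)) -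
      particleMean x.1 x.2 fun θ => Real.log (M.lik (Function.update θ j (x.1 j n))) := by
  refine (map_particleMean (weightCoord j n).toLinearMap x.1 x.2 (M.sampleGrad x)).trans ?_
  simp only [ContinuousLinearMap.coe_coe, weightCoord_apply, sampleGrad, gradW]
  rw [particleMean_sub, particleMean_const hw]

theorem jointParticle_mem_box (hx : x ∈ M.feasible Np) (ν : Fin J → Fin Np) :
    jointParticle x.1 ν ∈ M.box :=
  fun j => (hx j).1 (ν j)

section Gradient

namespace Regular

theorem lik_pos (hM : M.Regular) (θ : Fin J → ℝ) : 0 < M.lik θ := by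
  have noise_pos := hM.noise_pos
  exact Finset.prod_pos fun n _ => by positivity

theorem weight_pos (hM : M.Regular) (hx : x ∈ M.feasible Np) (j : Fin J) (n : Fin Np) :
    0 < x.2 j n :=
  hM.eps_pos.trans_le ((hx j).2.2 n).1

theorem objective_eq (hM : M.Regular) (hx : x ∈ M.feasible Np) :
    M.objective x = ∑ j, ∑ n, x.2 j n * (Real.log (x.2 j n) - Real.log (M.prior j (x.1 j n)))
      - particleMean x.1 x.2 fun θ => Real.log (M.lik θ) := by
  have log_ratio : ∀ ν : Fin J → Fin Np, Real.log (jointWeight x.2 ν /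
      (M.lik (jointParticle x.1 ν) * M.jointPrior (jointParticle x.1 ν)))
      = ∑ j, (Real.log (x.2 j (ν j)) - Real.log (M.prior j (x.1 j (ν j))))
        - Real.log (M.lik (jointParticle x.1 ν)) := fun ν => by
    have weight_ne : ∀ j, x.2 j (ν j) ≠ 0 := fun j => (hM.weight_pos hx j _).ne'
    have prior_ne : ∀ j, M.prior j (jointParticle x.1 ν j) ≠ 0 := fun j =>
      (hM.prior_pos j _ (jointParticle_mem_box hx ν j)).ne'
    have jointPrior_ne : M.jointPrior (jointParticle x.1 ν) ≠ 0 :=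
      Finset.prod_ne_zero_iff.2 fun j _ => prior_ne j
    rw [jointWeight, Real.log_div (Finset.prod_ne_zero_iff.2 fun j _ => weight_ne j)
      (mul_ne_zero (hM.lik_pos _).ne' jointPrior_ne), Real.log_mul (hM.lik_pos _).ne' jointPrior_ne,
      jointPrior, Real.log_prod fun j _ => weight_ne j,
      Real.log_prod fun j _ => prior_ne j, Finset.sum_sub_distrib, sub_sub,
      add_comm (Real.log _)]
    simp only [jointParticle]
  calc M.objective x = ∑ ν, jointWeight x.2 ν * Real.log (jointWeight x.2 ν /
        (M.lik (jointParticle x.1 ν) * M.jointPrior (jointParticle x.1 ν))) := rfl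
    _ = ∑ j, ∑ ν, jointWeight x.2 ν *
          (Real.log (x.2 j (ν j)) - Real.log (M.prior j (x.1 j (ν j))))
        - particleMean x.1 x.2 fun θ => Real.log (M.lik θ) := by
      rw [Finset.sum_comm, particleMean, ← Finset.sum_sub_distrib]
      exact Finset.sum_congr rfl fun ν _ => by
        rw [log_ratio, mul_sub, Finset.mul_sum, smul_eq_mul]
    _ = _ := by
      congr 1
      exact Finset.sum_congr rfl fun j _ => sum_jointWeight_mul_apply (fun j => (hx j).2.1) j
        fun n => Real.log (x.2 j n) - Real.log (M.prior j (x.1 j n))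

-- If the search interval is degenerate, the score is `0` by convention, but then there is no
-- feasible direction in the positions.
theorem mul_mean_score (hx : x ∈ M.feasible Np) {y : Config J Np} (hy : y ∈ M.feasible Np)
    (j : Fin J) (n : Fin Np) {a' : ℝ →L[ℝ] ℝ} {l' : (Fin J → ℝ) → (Fin J → ℝ) →L[ℝ] ℝ}
    (ha : HasFDerivWithinAt (fun s => Real.log (M.prior j s)) a' (M.interval j) (x.1 j n))
    (hl : ∀ θ ∈ M.box, HasFDerivWithinAt (fun θ => Real.log (M.lik θ)) (l' θ) M.box θ) :
    (particleMean x.1 x.2 fun θ => M.score j (Function.update θ j (x.1 j n))) * (y - x).1 j n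
      = (a' 1 + particleMean x.1 x.2 fun θ => l' (Function.update θ j (x.1 j n)) (Pi.single j 1))
        * (y - x).1 j n := by
  rcases le_or_gt (M.width j) 0 with hj | hj
  · have no_direction : (y - x).1 j n = 0 :=
      sub_eq_zero.2 (M.subsingleton_interval hj ((hy j).1 n) ((hx j).1 n))
    rw [no_direction, mul_zero, mul_zero]
  have score_mean : Set.EqOn (fun θ => M.score j (Function.update θ j (x.1 j n)))
      (fun θ => a' 1 + l' (Function.update θ j (x.1 j n)) (Pi.single j 1)) M.box := fun θ hθ => by
    have update_mem := M.update_mem_box hθ ((hx j).1 n)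
    exact M.score_eq hj update_mem (by rwa [Function.update_self]) (hl _ update_mem)
  rw [particleMean_congr (jointParticle_mem_box hx) x.2 score_mean, particleMean_add,
    particleMean_const fun j => (hx j).2.1]

theorem hasFDerivWithinAt_objective (hM : M.Regular) (hx : x ∈ M.feasible Np) :
    HasFDerivWithinAt M.objective (pairing (M.meanGrad x)) (M.feasible Np) x := by
  have hw : ∀ j, ∑ n, x.2 j n = 1 := fun j => (hx j).2.1
  choose a' k ha _ using hM.log_prior
  obtain ⟨l', _, hl, _⟩ := hM.log_lik
  have marginal_part := hasFDerivWithinAt_sum_mul_log_sub (s := M.feasible Np)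
    (fun y hy j => (hy j).1) (fun j n => (hM.weight_pos hx j n).ne')
    fun j n => (ha j _ ((hx j).1 n)).hasDerivWithinAt
  have lik_part := hasFDerivWithinAt_particleMean (s := M.feasible Np) hw
    (fun y hy => jointParticle_mem_box hy) hx hl
  refine hasFDerivWithinAt_congr_directions ((marginal_part.sub lik_part).congr
    (fun y hy => hM.objective_eq hy) (hM.objective_eq hx)) fun y hy => ?_
  rw [← pairing_sub, pairing_apply, pairing_apply]
  refine Finset.sum_congr rfl fun j _ => Finset.sum_congr rfl fun n _ => ?_
  have score_part := mul_mean_score hx hy j n (ha j _ ((hx j).1 n)) hl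
  simp only [meanGrad_fst_apply, meanGrad_snd_apply hw, Prod.fst_sub, Prod.snd_sub,
    Pi.sub_apply] at score_part ⊢
  linear_combination x.2 j n * score_part

end Regular

end Gradient

section LipschitzGradient

theorem locallyLipschitzOn_particleMean {F : Type*} [NormedAddCommGroup F] [NormedSpace ℝ F]
    {s : Set (Config J Np)} {S : Set (Fin J → ℝ)} (hs : ∀ x ∈ s, ∀ ν, jointParticle x.1 ν ∈ S)
    {Φ : Config J Np × (Fin J → ℝ) → F} (hΦ : LocallyLipschitzOn (s ×ˢ S) Φ) :
    LocallyLipschitzOn s fun x => particleMean x.1 x.2 fun θ => Φ (x, θ) := by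
  have smooth : ∀ {G : Type} [NormedAddCommGroup G] [NormedSpace ℝ G] {f : Config J Np → G},
      ContDiff ℝ 1 f → LocallyLipschitzOn s f := fun hf => hf.locallyLipschitz.locallyLipschitzOn
  refine locallyLipschitzOn_sum fun ν => locallyLipschitzOn_smul
    (smooth (contDiff_prod fun j _ => by fun_prop)) ?_
  exact locallyLipschitzOn_comp hΦ (locallyLipschitzOn_prodMk (smooth contDiff_id)
    (smooth (f := fun x => jointParticle x.1 ν) (by unfold jointParticle; fun_prop)))
    fun x hx => ⟨hx, hs x hx ν⟩

theorem Regular.locallyLipschitzOn_sampleGrad (hM : M.Regular) :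
    LocallyLipschitzOn (M.feasible Np ×ˢ M.box)
      fun z : Config J Np × (Fin J → ℝ) => M.sampleGrad z.1 z.2 := by
  have smooth : ∀ {f : Config J Np × (Fin J → ℝ) → ℝ}, ContDiff ℝ 1 f →
      LocallyLipschitzOn (M.feasible Np ×ˢ M.box) f :=
    fun hf => hf.locallyLipschitz.locallyLipschitzOn
  have resample : ∀ j n, LocallyLipschitzOn (M.feasible Np ×ˢ M.box)
      fun z : Config J Np × (Fin J → ℝ) => Function.update z.2 j (z.1.1 j n) := fun j n =>
    locallyLipschitzOn_pi fun i => by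
      rcases eq_or_ne i j with rfl | hi
      · simpa only [Function.update_self] using smooth (by fun_prop)
      · simpa only [Function.update_of_ne hi] using smooth (by fun_prop)
  have resample_mem : ∀ j n, Set.MapsTo (fun z : Config J Np × (Fin J → ℝ) =>
      Function.update z.2 j (z.1.1 j n)) (M.feasible Np ×ˢ M.box) M.box := fun j n z hz =>
    M.update_mem_box hz.2 ((hz.1 j).1 n)
  refine locallyLipschitzOn_prodMk
    (locallyLipschitzOn_pi fun j => locallyLipschitzOn_pi fun n => ?_)
    (locallyLipschitzOn_pi fun j => locallyLipschitzOn_pi fun n => ?_)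
  · simp only [gradP_eq]
    exact locallyLipschitzOn_smul (smooth (by fun_prop))
      (locallyLipschitzOn_comp (hM.locallyLipschitzOn_score j) (resample j n) (resample_mem j n))
  · have log_weight : LocallyLipschitzOn (M.feasible Np ×ˢ M.box)
        fun z : Config J Np × (Fin J → ℝ) => Real.log (z.1.2 j n) :=
      locallyLipschitzOn_comp locallyLipschitzOn_log (smooth (by fun_prop))
        fun z hz => hM.weight_pos hz.1 j n
    have log_prior : LocallyLipschitzOn (M.feasible Np ×ˢ M.box)
        fun z : Config J Np × (Fin J → ℝ) => Real.log (M.prior j (z.1.1 j n)) :=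
      locallyLipschitzOn_comp (locallyLipschitzOn_of_lipschitzGradientOn (M.convex_interval j)
        (hM.log_prior j)) (smooth (by fun_prop)) fun z hz => (hz.1 j).1 n
    have log_lik : LocallyLipschitzOn (M.feasible Np ×ˢ M.box)
        fun z : Config J Np × (Fin J → ℝ) =>
          Real.log (M.lik (Function.update z.2 j (z.1.1 j n))) :=
      locallyLipschitzOn_comp (locallyLipschitzOn_of_lipschitzGradientOn M.convex_box hM.log_lik)
        (resample j n) (resample_mem j n)
    exact ((log_weight.add (smooth (f := fun _ => 1) contDiff_const)).sub log_prior).sub log_lik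

theorem Regular.locallyLipschitzOn_meanGrad (hM : M.Regular) :
    LocallyLipschitzOn (M.feasible Np) M.meanGrad :=
  locallyLipschitzOn_particleMean (fun _ hx => jointParticle_mem_box hx)
    hM.locallyLipschitzOn_sampleGrad

end LipschitzGradient

end Model

section ParticleLaw

variable {J Np : ℕ} {p w : Particles J Np}

theorem isProbabilityMeasure_sum_dirac {ι X : Type*} [Fintype ι] [MeasurableSpace X] {v : ι → ℝ}
    (hv : ∀ i, 0 ≤ v i) (hv1 : ∑ i, v i = 1) (x : ι → X) :
    IsProbabilityMeasure (∑ i, ENNReal.ofReal (v i) • Measure.dirac (x i)) :=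
  ⟨by simp only [Measure.finsetSum_apply, Measure.smul_apply, measure_univ, smul_eq_mul, mul_one,
    ← ENNReal.ofReal_sum_of_nonneg fun i _ => hv i, hv1, ENNReal.ofReal_one]⟩

theorem isProbabilityMeasure_particleLaw (hw : ∀ j n, 0 ≤ w j n) (hw1 : ∀ j, ∑ n, w j n = 1) :
    IsProbabilityMeasure (particleLaw p w) := by
  have := fun j => isProbabilityMeasure_sum_dirac (hw j) (hw1 j) (p j)
  unfold particleLaw
  infer_instance

theorem particleLaw_eq_sum (hw : ∀ j n, 0 ≤ w j n) (hw1 : ∀ j, ∑ n, w j n = 1) :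
    particleLaw p w = ∑ ν : Fin J → Fin Np, ENNReal.ofReal (jointWeight w ν) •
      Measure.dirac (jointParticle p ν) := by
  have := fun j => isProbabilityMeasure_sum_dirac (hw j) (hw1 j) (p j)
  refine Measure.pi_eq fun s hs => ?_
  simp only [Measure.finsetSum_apply, Measure.smul_apply, smul_eq_mul]
  rw [Finset.prod_univ_sum, Fintype.piFinset_univ]
  refine Finset.sum_congr rfl fun ν _ => ?_
  rw [Finset.prod_mul_distrib, jointWeight, ENNReal.ofReal_prod_of_nonneg fun j _ => hw j _,
    Measure.dirac_apply' _ (MeasurableSet.univ_pi hs)]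
  congr 1
  by_cases hν : jointParticle p ν ∈ Set.univ.pi s
  · rw [Set.indicator_of_mem hν, Pi.one_apply]
    refine (Finset.prod_eq_one fun j _ => ?_).symm
    exact (Measure.dirac_apply' _ (hs j)).trans (Set.indicator_of_mem (hν j trivial) _)
  · rw [Set.indicator_of_notMem hν]
    obtain ⟨j, hj⟩ : ∃ j, p j (ν j) ∉ s j := by simpa [jointParticle] using hν
    refine (Finset.prod_eq_zero (Finset.mem_univ j) ?_).symm
    rw [Measure.dirac_apply' _ (hs j), Set.indicator_of_notMem hj]

theorem integrable_particleLaw {F : Type*} [NormedAddCommGroup F] (hw : ∀ j n, 0 ≤ w j n)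
    (hw1 : ∀ j, ∑ n, w j n = 1) (φ : (Fin J → ℝ) → F) : Integrable φ (particleLaw p w) := by
  rw [particleLaw_eq_sum hw hw1]
  exact integrable_finsetSum_measure.2 fun ν _ =>
    (integrable_dirac enorm_lt_top).smul_measure ENNReal.ofReal_ne_top

theorem integral_particleLaw {F : Type*} [NormedAddCommGroup F] [NormedSpace ℝ F]
    [CompleteSpace F] (hw : ∀ j n, 0 ≤ w j n) (hw1 : ∀ j, ∑ n, w j n = 1)
    (φ : (Fin J → ℝ) → F) : ∫ θ, φ θ ∂particleLaw p w = particleMean p w φ := by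
  rw [particleLaw_eq_sum hw hw1, integral_finsetSum_measure fun ν _ =>
    (integrable_dirac enorm_lt_top).smul_measure ENNReal.ofReal_ne_top]
  refine Finset.sum_congr rfl fun ν _ => ?_
  rw [integral_smul_measure, integral_dirac,
    ENNReal.toReal_ofReal (show 0 ≤ jointWeight w ν from Finset.prod_nonneg fun j _ => hw j _)]

theorem measureReal_particleLaw_eq_one (hw : ∀ j n, 0 ≤ w j n) (hw1 : ∀ j, ∑ n, w j n = 1)
    {S : Set (Fin J → ℝ)} (hS : MeasurableSet S) (hp : ∀ ν, jointParticle p ν ∈ S) :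
    (particleLaw p w).real S = 1 := by
  rw [← integral_indicator_one hS, integral_particleLaw hw hw1,
    particleMean_congr hp w (Set.eqOn_indicator), ← particleMean_const hw1 p (1 : ℝ)]
  rfl

theorem measurable_particleLaw {Ω : Type*} {m : MeasurableSpace Ω} {p w : Ω → Particles J Np}
    (hp : Measurable p) (hw : Measurable w) (hw0 : ∀ ω j n, 0 ≤ w ω j n)
    (hw1 : ∀ ω j, ∑ n, w ω j n = 1) : Measurable fun ω => particleLaw (p ω) (w ω) := by
  refine measurable_measure_pi (fun j => Measure.measurable_of_measurable_coe _ fun s hs => ?_)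
    fun j ω => isProbabilityMeasure_sum_dirac (hw0 ω j) (hw1 ω j) (p ω j)
  simp only [Measure.finsetSum_apply, Measure.smul_apply, smul_eq_mul]
  have mass : ∀ n, Measurable fun ω => ENNReal.ofReal (w ω j n) := fun n => by fun_prop
  have atom : ∀ n, Measurable fun ω => Measure.dirac (p ω j n) s := fun n =>
    (Measure.measurable_coe hs).comp (Measure.measurable_dirac.comp (by fun_prop))
  exact Finset.measurable_fun_sum _ fun n _ => (mass n).mul (atom n)

theorem integral_pi_average {ι Θ F : Type*} [Fintype ι] [Nonempty ι] [MeasurableSpace Θ]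
    [NormedAddCommGroup F] [NormedSpace ℝ F] (ν : Measure Θ) [IsProbabilityMeasure ν]
    {φ : Θ → F} (hφ : Integrable φ ν) :
    ∫ θ, (Fintype.card ι : ℝ)⁻¹ • ∑ b, φ (θ b) ∂Measure.pi (fun _ : ι => ν) = ∫ s, φ s ∂ν := by
  have marginal : ∀ b, (Measure.pi fun _ : ι => ν).map (Function.eval b) = ν := fun b =>
    (measurePreserving_eval (fun _ : ι => ν) b).map_eq
  have integrable_eval : ∀ b, Integrable (fun θ : ι → Θ => φ (θ b)) (Measure.pi fun _ => ν) :=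
    fun b => Integrable.comp_measurable (by rwa [marginal b]) (measurable_pi_apply b)
  have integral_eval : ∀ b, ∫ θ, φ (θ b) ∂Measure.pi (fun _ : ι => ν) = ∫ s, φ s ∂ν := fun b => by
    conv_rhs => rw [← marginal b]
    refine (integral_map (measurable_pi_apply b).aemeasurable ?_).symm
    rw [marginal b]
    exact hφ.1
  have card_ne : (Fintype.card ι : ℝ) ≠ 0 := Nat.cast_ne_zero.2 Fintype.card_ne_zero
  rw [integral_smul, integral_finsetSum _ fun b _ => integrable_eval b]
  simp only [integral_eval, Finset.sum_const, Finset.card_univ, ← Nat.cast_smul_eq_nsmul ℝ]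
  rw [inv_smul_smul₀ card_ne]

end ParticleLaw

section Projection

open scoped RealInnerProductSpace

theorem IsProj.sum_mul_nonpos {n : ℕ} {S : Set (Fin n → ℝ)} (hS : Convex ℝ S) {x y : Fin n → ℝ}
    (h : IsProj S x y) {z : Fin n → ℝ} (hz : z ∈ S) : ∑ i, (x i - y i) * (z i - y i) ≤ 0 := by
  let K : Set (EuclideanSpace ℝ (Fin n)) := WithLp.ofLp ⁻¹' S
  have hK : Convex ℝ K := hS.linear_preimage (WithLp.linearEquiv 2 ℝ (Fin n → ℝ)).toLinearMap
  have hy : WithLp.toLp 2 y ∈ K := h.1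
  have minimal : ‖WithLp.toLp 2 x - WithLp.toLp 2 y‖ = ⨅ v : K, ‖WithLp.toLp 2 x - v‖ := by
    have : Nonempty K := ⟨⟨_, hy⟩⟩
    refine le_antisymm (le_ciInf fun v => ?_)
      (ciInf_le ⟨0, Set.forall_mem_range.2 fun v => norm_nonneg _⟩ (⟨_, hy⟩ : K))
    rw [EuclideanSpace.norm_eq, EuclideanSpace.norm_eq]
    simpa only [PiLp.sub_apply, Real.norm_eq_abs, sq_abs] using Real.sqrt_le_sqrt (h.2 v.1 v.2)
  have variational := (norm_eq_iInf_iff_real_inner_le_zero hK hy).1 minimal (WithLp.toLp 2 z) hz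
  rw [PiLp.inner_apply] at variational
  exact (Finset.sum_congr rfl fun i _ => mul_comm _ _).trans_le variational

theorem IsProj.sum_step_le {n : ℕ} {S : Set (Fin n → ℝ)} (hS : Convex ℝ S) {x g y : Fin n → ℝ}
    {Γ : ℝ} (hΓ : 0 < Γ) (h : IsProj S (fun i => x i - Γ * g i) y) {z : Fin n → ℝ} (hz : z ∈ S) :
    ∑ i, g i * (y i - z i) ≤ ∑ i, Γ⁻¹ * ((x i - y i) * (y i - z i)) := by
  have variational := h.sum_mul_nonpos hS hz
  have expand : ∑ i, (x i - Γ * g i - y i) * (z i - y i)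
      = Γ * ∑ i, g i * (y i - z i) - ∑ i, (x i - y i) * (y i - z i) := by
    rw [Finset.mul_sum, ← Finset.sum_sub_distrib]
    exact Finset.sum_congr rfl fun i _ => by ring
  rw [← Finset.mul_sum, inv_mul_eq_div, le_div_iff₀ hΓ]
  linarith

variable {ι : Type*} [Fintype ι] {Γ : ι → ℝ}

theorem sum_inv_mul_mul_le {Γmin : ℝ} (hΓmin : 0 < Γmin) (hΓ : ∀ i, Γmin ≤ Γ i)
    (u v : EuclideanSpace ℝ ι) : ∑ i, (Γ i)⁻¹ * (u i * v i) ≤ Γmin⁻¹ * ‖u‖ * ‖v‖ := by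
  calc ∑ i, (Γ i)⁻¹ * (u i * v i) ≤ ∑ i, Γmin⁻¹ * (|u i| * |v i|) := by
        refine Finset.sum_le_sum fun i _ => ?_
        rw [← abs_mul]
        have inv_nonneg : 0 ≤ (Γ i)⁻¹ := inv_nonneg.2 (hΓmin.le.trans (hΓ i))
        have inv_le : (Γ i)⁻¹ ≤ Γmin⁻¹ := inv_anti₀ hΓmin (hΓ i)
        exact (mul_le_mul_of_nonneg_left (le_abs_self _) inv_nonneg).trans
          (mul_le_mul_of_nonneg_right inv_le (abs_nonneg _))
    _ ≤ Γmin⁻¹ * (‖u‖ * ‖v‖) := by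
        rw [← Finset.mul_sum, EuclideanSpace.norm_eq, EuclideanSpace.norm_eq]
        exact mul_le_mul_of_nonneg_left (Real.sum_mul_le_sqrt_mul_sqrt _ _ _)
          (inv_nonneg.2 hΓmin.le)
    _ = Γmin⁻¹ * ‖u‖ * ‖v‖ := (mul_assoc _ _ _).symm

theorem inv_mul_norm_sq_le_sum {Γmax : ℝ} (hΓ : ∀ i, 0 < Γ i) (hΓmax : ∀ i, Γ i ≤ Γmax)
    (u : EuclideanSpace ℝ ι) : Γmax⁻¹ * ‖u‖ ^ 2 ≤ ∑ i, (Γ i)⁻¹ * (u i * u i) := by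
  rw [EuclideanSpace.real_norm_sq_eq, Finset.mul_sum]
  refine Finset.sum_le_sum fun i _ => ?_
  rw [sq]
  exact mul_le_mul_of_nonneg_right (inv_anti₀ (hΓ i) (hΓmax i)) (mul_self_nonneg _)

end Projection

section BatchGradient

variable {J N Np B : ℕ} {M : Model J N}

/-- The mini-batch average of the instantaneous gradients. -/
noncomputable def Model.batchGrad (M : Model J N) (x : Config J Np) (θ : Fin B → Fin J → ℝ) :
    Config J Np :=
  (B : ℝ)⁻¹ • ∑ b, M.sampleGrad x (θ b)

/-- The error of the mini-batch gradient as an estimate of the mean gradient, as one vector. -/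
noncomputable def Model.gradNoise (M : Model J N) (x : Config J Np) (θ : Fin B → Fin J → ℝ) :
    FlatConfig J Np :=
  flatten J Np (M.batchGrad x θ - M.meanGrad x)

/-- The law of a mini-batch drawn at the current positions and weights. -/
noncomputable def batchLaw (B : ℕ) (x : Config J Np) : Measure (Fin B → Fin J → ℝ) :=
  Measure.pi fun _ => particleLaw x.1 x.2

/-- The mini-batches all of whose samples lie in the search box. -/
def Model.batchBox (M : Model J N) (B : ℕ) : Set (Fin B → Fin J → ℝ) := Set.univ.pi fun _ => M.box

theorem Model.isCompact_batchBox : IsCompact (M.batchBox B) :=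
  isCompact_univ_pi fun _ => M.isCompact_box

namespace Model.Regular

variable {x : Config J Np}

theorem isProbabilityMeasure_batchLaw (hM : M.Regular) (hx : x ∈ M.feasible Np) :
    IsProbabilityMeasure (batchLaw B x) := by
  have := isProbabilityMeasure_particleLaw (p := x.1) (fun j n => (hM.weight_pos hx j n).le)
    fun j => (hx j).2.1
  exact Measure.pi.instIsProbabilityMeasure _

theorem measureReal_batchLaw_batchBox (hM : M.Regular) (hx : x ∈ M.feasible Np) :
    (batchLaw B x).real (M.batchBox B) = 1 := by
  have hw : ∀ j n, 0 ≤ x.2 j n := fun j n => (hM.weight_pos hx j n).le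
  have := isProbabilityMeasure_particleLaw (p := x.1) hw fun j => (hx j).2.1
  have box_mass := measureReal_particleLaw_eq_one hw (fun j => (hx j).2.1)
    M.isCompact_box.measurableSet (jointParticle_mem_box hx)
  rw [batchLaw, batchBox, Measure.real, Measure.pi_pi, ENNReal.toReal_prod]
  exact Finset.prod_eq_one fun _ _ => box_mass

theorem integral_batchGrad (hM : M.Regular) (hx : x ∈ M.feasible Np) (hB : 0 < B) :
    ∫ θ, M.batchGrad x θ ∂batchLaw B x = M.meanGrad x := by
  have hw : ∀ j n, 0 ≤ x.2 j n := fun j n => (hM.weight_pos hx j n).le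
  have hw1 : ∀ j, ∑ n, x.2 j n = 1 := fun j => (hx j).2.1
  have := isProbabilityMeasure_particleLaw (p := x.1) hw hw1
  have : Nonempty (Fin B) := ⟨⟨0, hB⟩⟩
  have average := integral_pi_average (ι := Fin B) (particleLaw x.1 x.2)
    (integrable_particleLaw hw hw1 (M.sampleGrad x))
  rw [Fintype.card_fin] at average
  exact average.trans (integral_particleLaw hw hw1 _)

theorem integrable_batchGrad (hM : M.Regular) (hx : x ∈ M.feasible Np) :
    Integrable (M.batchGrad x) (batchLaw B x) := by
  have hw : ∀ j n, 0 ≤ x.2 j n := fun j n => (hM.weight_pos hx j n).le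
  have hw1 : ∀ j, ∑ n, x.2 j n = 1 := fun j => (hx j).2.1
  have := isProbabilityMeasure_particleLaw (p := x.1) hw hw1
  have integrable_sample : ∀ b, Integrable
      (fun θ : Fin B → Fin J → ℝ => M.sampleGrad x (θ b)) (batchLaw B x) := fun b =>
    (measurePreserving_eval (fun _ : Fin B => particleLaw x.1 x.2) b).integrable_comp_of_integrable
      (integrable_particleLaw hw hw1 (M.sampleGrad x))
  exact (integrable_finsetSum _ fun b _ => integrable_sample b).smul (B : ℝ)⁻¹

theorem integral_gradNoise (hM : M.Regular) (hx : x ∈ M.feasible Np) (hB : 0 < B) :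
    ∫ θ, M.gradNoise x θ ∂batchLaw B x = 0 := by
  have := hM.isProbabilityMeasure_batchLaw (B := B) hx
  have centered : ∫ θ, (M.batchGrad x θ - M.meanGrad x) ∂batchLaw B x = 0 := by
    rw [integral_sub (hM.integrable_batchGrad hx) (integrable_const _),
      hM.integral_batchGrad hx hB, integral_const, probReal_univ, one_smul, sub_self]
  calc ∫ θ, M.gradNoise x θ ∂batchLaw B x
      = flatten J Np (∫ θ, (M.batchGrad x θ - M.meanGrad x) ∂batchLaw B x) :=
        ContinuousLinearEquiv.integral_comp_comm _ _
    _ = 0 := by rw [centered, map_zero]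

theorem continuousOn_batchGrad (hM : M.Regular) :
    ContinuousOn (fun z : Config J Np × (Fin B → Fin J → ℝ) => M.batchGrad z.1 z.2)
      (M.feasible Np ×ˢ M.batchBox B) := by
  have continuousOn_sample : ∀ b, ContinuousOn
      (fun z : Config J Np × (Fin B → Fin J → ℝ) => M.sampleGrad z.1 (z.2 b))
      (M.feasible Np ×ˢ M.batchBox B) := fun b =>
    hM.locallyLipschitzOn_sampleGrad.continuousOn.comp
      (f := fun z : Config J Np × (Fin B → Fin J → ℝ) => (z.1, z.2 b))
      (by fun_prop) fun z hz => ⟨hz.1, hz.2 b trivial⟩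
  exact (continuousOn_finsetSum _ fun b _ => continuousOn_sample b).const_smul (B : ℝ)⁻¹

theorem continuousOn_gradNoise (hM : M.Regular) :
    ContinuousOn (fun z : Config J Np × (Fin B → Fin J → ℝ) => M.gradNoise z.1 z.2)
      (M.feasible Np ×ˢ M.batchBox B) := by
  have continuousOn_mean : ContinuousOn
      (fun z : Config J Np × (Fin B → Fin J → ℝ) => M.meanGrad z.1)
      (M.feasible Np ×ˢ M.batchBox B) :=
    hM.locallyLipschitzOn_meanGrad.continuousOn.comp continuousOn_fst fun z hz => hz.1
  exact (flatten J Np).continuous.comp_continuousOn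
    (hM.continuousOn_batchGrad.sub continuousOn_mean)

end Model.Regular

theorem measurable_batchLaw {Ω : Type*} {m : MeasurableSpace Ω} {x : Ω → Config J Np}
    (hM : M.Regular) (hx : Measurable x) (hxM : ∀ ω, x ω ∈ M.feasible Np) :
    Measurable fun ω => batchLaw B (x ω) := by
  have hw : ∀ ω j n, 0 ≤ (x ω).2 j n := fun ω j n => (hM.weight_pos (hxM ω) j n).le
  exact measurable_measure_pi
    (fun _ => measurable_particleLaw hx.fst hx.snd hw fun ω j => (hxM ω j).2.1)
    fun _ ω => isProbabilityMeasure_particleLaw (hw ω) fun j => (hxM ω j).2.1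

end BatchGradient

namespace IsRun

variable {J N Np B : ℕ} {M : Model J N} {ρ γ : ℕ → ℝ} {Γp Γw : ℕ → Fin J → ℝ}
  {Ω : Type*} {mΩ : MeasurableSpace Ω} {μ : Measure Ω} {ℱ : Filtration ℕ mΩ}
  {p w fp fw pbar wbar : ℕ → Ω → Particles J Np} {θ : ℕ → Ω → Fin B → Fin J → ℝ}

section Iterates

theorem bar_mem (h : IsRun M ρ γ Γp Γw μ ℱ p w fp fw pbar wbar θ) (t : ℕ) (ω : Ω) :
    (pbar t ω, wbar t ω) ∈ M.feasible Np :=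
  fun j => ⟨(h.pbar_proj t ω j).1, (h.wbar_proj t ω j).1⟩

theorem iterate_succ (h : IsRun M ρ γ Γp Γw μ ℱ p w fp fw pbar wbar θ) (t : ℕ) (ω : Ω) :
    (p (t + 1) ω, w (t + 1) ω)
      = (p t ω, w t ω) + γ t • ((pbar t ω, wbar t ω) - (p t ω, w t ω)) := by
  ext j n
  · simp only [h.p_succ, Prod.fst_add, Prod.smul_fst, Prod.fst_sub, Pi.add_apply, Pi.smul_apply,
      Pi.sub_apply, smul_eq_mul]
    ring
  · simp only [h.w_succ, Prod.snd_add, Prod.smul_snd, Prod.snd_sub, Pi.add_apply, Pi.smul_apply,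
      Pi.sub_apply, smul_eq_mul]
    ring

theorem mem_feasible (h : IsRun M ρ γ Γp Γw μ ℱ p w fp fw pbar wbar θ) (hst : StepRules ρ γ)
    (t : ℕ) (ω : Ω) : (p t ω, w t ω) ∈ M.feasible Np := by
  induction t with
  | zero => exact h.init ω
  | succ t ih =>
    rw [h.iterate_succ]
    exact M.convex_feasible.add_smul_sub_mem ih (h.bar_mem t ω) (hst.gamma_mem t)

theorem measurable_iterate (h : IsRun M ρ γ Γp Γw μ ℱ p w fp fw pbar wbar θ) (t : ℕ) :
    Measurable[ℱ t] fun ω => (p t ω, w t ω) :=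
  (h.adapted_p t).prodMk (h.adapted_w t)

theorem gradient_succ (h : IsRun M ρ γ Γp Γw μ ℱ p w fp fw pbar wbar θ) (t : ℕ) (ω : Ω) :
    (fp (t + 1) ω, fw (t + 1) ω) = (1 - ρ t) • (fp t ω, fw t ω)
      + ρ t • M.batchGrad (p t ω, w t ω) (θ t ω) := by
  ext j n
  · simp only [h.fp_succ, Model.batchGrad, Model.sampleGrad, Prod.fst_add, Prod.smul_fst,
      Prod.fst_sum, Pi.add_apply, Pi.smul_apply, Finset.sum_apply, smul_eq_mul]
    ring
  · simp only [h.fw_succ, Model.batchGrad, Model.sampleGrad, Prod.snd_add, Prod.smul_snd,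
      Prod.snd_sum, Pi.add_apply, Pi.smul_apply, Finset.sum_apply, smul_eq_mul]
    ring

end Iterates

section Noise

variable [IsProbabilityMeasure μ]

theorem ae_batch_mem (h : IsRun M ρ γ Γp Γw μ ℱ p w fp fw pbar wbar θ) (hM : M.Regular)
    (hst : StepRules ρ γ) (t : ℕ) : ∀ᵐ ω ∂μ, θ t ω ∈ M.batchBox B := by
  have hbox : MeasurableSet (M.batchBox B) := M.isCompact_batchBox.measurableSet
  have hθ : Measurable (θ t) := (h.adapted_sample t).mono (ℱ.le _) le_rfl
  have mass : ∀ ω, (batchLaw B (p t ω, w t ω)).real (M.batchBox B) = 1 := fun ω =>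
    hM.measureReal_batchLaw_batchBox (h.mem_feasible hst t ω)
  exact ae_mem_of_condExp_indicator_ae_eq_one (ℱ.le t) (hθ hbox)
    ((h.sample_law t _ hbox).trans (.of_forall mass))

theorem ae_mem_feasible_prod_batchBox (h : IsRun M ρ γ Γp Γw μ ℱ p w fp fw pbar wbar θ)
    (hM : M.Regular) (hst : StepRules ρ γ) (t : ℕ) :
    ∀ᵐ ω ∂μ, ((p t ω, w t ω), θ t ω) ∈ M.feasible Np ×ˢ M.batchBox B := by
  filter_upwards [h.ae_batch_mem hM hst t] with ω hω
  exact ⟨h.mem_feasible hst t ω, hω⟩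

theorem aestronglyMeasurable_map_gradNoise (h : IsRun M ρ γ Γp Γw μ ℱ p w fp fw pbar wbar θ)
    (hM : M.Regular) (hst : StepRules ρ γ) (t : ℕ) :
    AEStronglyMeasurable (fun z : Config J Np × (Fin B → Fin J → ℝ) => M.gradNoise z.1 z.2)
      (μ.map fun ω => ((p t ω, w t ω), θ t ω)) := by
  have hS : MeasurableSet (M.feasible Np ×ˢ M.batchBox B) :=
    M.isCompact_feasible.measurableSet.prod M.isCompact_batchBox.measurableSet
  have hZ : Measurable fun ω => ((p t ω, w t ω), θ t ω) :=
    ((h.measurable_iterate t).mono (ℱ.le t) le_rfl).prodMk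
      ((h.adapted_sample t).mono (ℱ.le _) le_rfl)
  exact aestronglyMeasurable_map_of_continuousOn hS hM.continuousOn_gradNoise hZ
    (h.ae_mem_feasible_prod_batchBox hM hst t)

theorem aestronglyMeasurable_gradNoise (h : IsRun M ρ γ Γp Γw μ ℱ p w fp fw pbar wbar θ)
    (hM : M.Regular) (hst : StepRules ρ γ) (t : ℕ) :
    AEStronglyMeasurable[ℱ (t + 1)] (fun ω => M.gradNoise (p t ω, w t ω) (θ t ω)) μ := by
  have hZ : Measurable[ℱ (t + 1)] fun ω => ((p t ω, w t ω), θ t ω) :=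
    ((h.measurable_iterate t).mono (ℱ.mono t.le_succ) le_rfl).prodMk (h.adapted_sample t)
  have measurable_noise := aestronglyMeasurable_comp_of_map (ℱ.le (t + 1)) hZ
    (h.aestronglyMeasurable_map_gradNoise hM hst t)
  exact measurable_noise

theorem exists_ae_norm_gradNoise_le (h : IsRun M ρ γ Γp Γw μ ℱ p w fp fw pbar wbar θ)
    (hM : M.Regular) (hst : StepRules ρ γ) :
    ∃ σ : ℝ, ∀ t, ∀ᵐ ω ∂μ, ‖M.gradNoise (p t ω, w t ω) (θ t ω)‖ ≤ σ := by
  have hS : IsCompact (M.feasible Np ×ˢ M.batchBox B) :=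
    M.isCompact_feasible.prod M.isCompact_batchBox
  obtain ⟨σ, hσ⟩ := hS.exists_bound_of_continuousOn (hM.continuousOn_gradNoise (Np := Np))
  refine ⟨σ, fun t => ?_⟩
  filter_upwards [h.ae_mem_feasible_prod_batchBox hM hst t] with ω hω
  exact hσ ((p t ω, w t ω), θ t ω) hω

theorem memLp_gradNoise (h : IsRun M ρ γ Γp Γw μ ℱ p w fp fw pbar wbar θ)
    (hM : M.Regular) (hst : StepRules ρ γ) (t : ℕ) (q : ENNReal) :
    MemLp (fun ω => M.gradNoise (p t ω, w t ω) (θ t ω)) q μ := by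
  obtain ⟨σ, hσ⟩ := h.exists_ae_norm_gradNoise_le hM hst
  exact MemLp.of_bound ((h.aestronglyMeasurable_gradNoise hM hst t).mono (ℱ.le _)) σ (hσ t)

theorem condExp_gradNoise (h : IsRun M ρ γ Γp Γw μ ℱ p w fp fw pbar wbar θ) (hB : 0 < B)
    (hM : M.Regular) (hst : StepRules ρ γ) (t : ℕ) :
    μ[fun ω => M.gradNoise (p t ω, w t ω) (θ t ω) | ℱ t] =ᵐ[μ] 0 := by
  have hmem := h.mem_feasible hst t
  have law_measurable : Measurable[ℱ t] fun ω => batchLaw B (p t ω, w t ω) :=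
    measurable_batchLaw hM (h.measurable_iterate t) hmem
  have condExp_eq_integral := condExp_comp_ae_eq_integral (ℱ.le t) law_measurable
    (fun ω => hM.isProbabilityMeasure_batchLaw (hmem ω)) (h.measurable_iterate t)
    ((h.adapted_sample t).mono (ℱ.le _) le_rfl) (h.sample_law t)
    (h.aestronglyMeasurable_map_gradNoise hM hst t)
    ((h.memLp_gradNoise hM hst t 1).integrable le_rfl)
  exact condExp_eq_integral.trans (.of_forall fun ω => hM.integral_gradNoise (hmem ω) hB)

end Noise

end IsRun

section Flattened

open scoped RealInnerProductSpace

variable {J N Np : ℕ}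

namespace Model

variable (M : Model J N)

/-- The feasible set in the Euclidean space of all coordinates. -/
def flatFeasible (Np : ℕ) : Set (FlatConfig J Np) :=
  (flatten J Np).symm ⁻¹' M.feasible Np

/-- The objective as a function on the Euclidean space of all coordinates. -/
noncomputable def flatObjective (v : FlatConfig J Np) : ℝ :=
  M.objective ((flatten J Np).symm v)

/-- The mean gradient as a vector field on the Euclidean space of all coordinates. -/
noncomputable def flatGrad (v : FlatConfig J Np) : FlatConfig J Np :=
  flatten J Np (M.meanGrad ((flatten J Np).symm v))

theorem flatten_mem_flatFeasible {x : Config J Np} :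
    flatten J Np x ∈ M.flatFeasible Np ↔ x ∈ M.feasible Np := by
  rw [flatFeasible, Set.mem_preimage, ContinuousLinearEquiv.symm_apply_apply]

theorem flatGrad_flatten (x : Config J Np) :
    M.flatGrad (flatten J Np x) = flatten J Np (M.meanGrad x) := by
  rw [flatGrad, ContinuousLinearEquiv.symm_apply_apply]

theorem convex_flatFeasible : Convex ℝ (M.flatFeasible Np) :=
  M.convex_feasible.linear_preimage (flatten J Np).symm.toLinearMap

theorem isCompact_flatFeasible : IsCompact (M.flatFeasible Np) :=
  (flatten J Np).symm.toHomeomorph.isCompact_preimage.2 M.isCompact_feasible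

variable {M}

theorem Regular.hasGradientWithinAt_flatObjective (hM : M.Regular)
    {v : FlatConfig J Np} (hv : v ∈ M.flatFeasible Np) :
    HasGradientWithinAt M.flatObjective (M.flatGrad v) (M.flatFeasible Np) v := by
  have chain : HasFDerivWithinAt M.flatObjective
      (pairing (M.meanGrad ((flatten J Np).symm v)) ∘L (flatten J Np).symm.toContinuousLinearMap)
      (M.flatFeasible Np) v :=
    (hM.hasFDerivWithinAt_objective hv).comp v (flatten J Np).symm.hasFDerivWithinAt fun _ hu => hu
  have dual_eq : InnerProductSpace.toDual ℝ _ (M.flatGrad v)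
      = pairing (M.meanGrad ((flatten J Np).symm v)) ∘L
        (flatten J Np).symm.toContinuousLinearMap := by
    ext1 u
    simp only [pairing, flatGrad, InnerProductSpace.toDual_apply_apply,
      ContinuousLinearMap.comp_apply, ContinuousLinearEquiv.coe_coe,
      ContinuousLinearEquiv.apply_symm_apply, innerSL_apply_apply]
  exact chain.congr_fderiv dual_eq.symm

theorem Regular.exists_lipschitzOnWith_flatGrad (hM : M.Regular) :
    ∃ ℓ, LipschitzOnWith ℓ M.flatGrad (M.flatFeasible Np) := by
  have meanGrad_part : LocallyLipschitzOn (M.flatFeasible Np)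
      (M.meanGrad ∘ (flatten J Np).symm) :=
    locallyLipschitzOn_comp hM.locallyLipschitzOn_meanGrad
      (flatten J Np).symm.lipschitz.locallyLipschitz.locallyLipschitzOn fun _ hv => hv
  exact (locallyLipschitzOn_contDiff_comp (flatten J Np).contDiff meanGrad_part)
    |>.exists_lipschitzOnWith_of_compact M.isCompact_flatFeasible

end Model

end Flattened

namespace IsRun

open scoped RealInnerProductSpace

variable {J N Np B : ℕ} {M : Model J N} {ρ γ : ℕ → ℝ} {Γp Γw : ℕ → Fin J → ℝ}
  {Ω : Type*} {mΩ : MeasurableSpace Ω} {μ : Measure Ω} {ℱ : Filtration ℕ mΩ}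
  {p w fp fw pbar wbar : ℕ → Ω → Particles J Np} {θ : ℕ → Ω → Fin B → Fin J → ℝ}

theorem inner_gradient_le (h : IsRun M ρ γ Γp Γw μ ℱ p w fp fw pbar wbar θ)
    (hΓp : ∀ t j, 0 < Γp t j) (hΓw : ∀ t j, 0 < Γw t j) (t : ℕ) (ω : Ω)
    {y : Config J Np} (hy : y ∈ M.feasible Np) :
    ⟪flatten J Np (fp (t + 1) ω, fw (t + 1) ω), flatten J Np ((pbar t ω, wbar t ω) - y)⟫
      ≤ ∑ i, (Sum.elim (fun a => Γp t a.1) (fun a => Γw t a.1) i)⁻¹ *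
        (flatten J Np ((p t ω, w t ω) - (pbar t ω, wbar t ω)) i *
          flatten J Np ((pbar t ω, wbar t ω) - y) i) := by
  have position_step := fun j =>
    (h.pbar_proj t ω j).sum_step_le (M.convex_posSet j) (hΓp t j) (hy j).1
  have weight_step := fun j =>
    (h.wbar_proj t ω j).sum_step_le M.convex_weightSet (hΓw t j) (hy j).2
  rw [inner_flatten, Fintype.sum_sum_type, Fintype.sum_prod_type, Fintype.sum_prod_type,
    ← Finset.sum_add_distrib]
  refine Finset.sum_le_sum fun j _ => ?_
  rw [Finset.sum_add_distrib]
  exact add_le_add (position_step j) (weight_step j)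

theorem inner_gradient_le_mul_norm (h : IsRun M ρ γ Γp Γw μ ℱ p w fp fw pbar wbar θ) {Γmin : ℝ}
    (hΓmin : 0 < Γmin) (hΓp : ∀ t j, Γmin ≤ Γp t j) (hΓw : ∀ t j, Γmin ≤ Γw t j) (t : ℕ) (ω : Ω)
    {y : Config J Np} (hy : y ∈ M.feasible Np) :
    ⟪flatten J Np (fp (t + 1) ω, fw (t + 1) ω), flatten J Np ((pbar t ω, wbar t ω) - y)⟫
      ≤ Γmin⁻¹ * ‖flatten J Np ((pbar t ω, wbar t ω) - (p t ω, w t ω))‖ *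
        ‖flatten J Np ((pbar t ω, wbar t ω) - y)‖ := by
  have step := h.inner_gradient_le (fun t j => hΓmin.trans_le (hΓp t j))
    (fun t j => hΓmin.trans_le (hΓw t j)) t ω hy
  refine step.trans ((sum_inv_mul_mul_le hΓmin ?_ _ _).trans_eq ?_)
  · rintro (a | a)
    exacts [hΓp t a.1, hΓw t a.1]
  · rw [← norm_neg (flatten J Np ((p t ω, w t ω) - _)), ← map_neg, neg_sub]

theorem inner_gradient_le_neg_norm_sq (h : IsRun M ρ γ Γp Γw μ ℱ p w fp fw pbar wbar θ)
    (hst : StepRules ρ γ) {Γmax : ℝ} (hΓp : ∀ t j, Γp t j ∈ Set.Ioc 0 Γmax)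
    (hΓw : ∀ t j, Γw t j ∈ Set.Ioc 0 Γmax) (t : ℕ) (ω : Ω) :
    ⟪flatten J Np (fp (t + 1) ω, fw (t + 1) ω),
        flatten J Np ((pbar t ω, wbar t ω) - (p t ω, w t ω))⟫
      ≤ -Γmax⁻¹ * ‖flatten J Np ((pbar t ω, wbar t ω) - (p t ω, w t ω))‖ ^ 2 := by
  have step := h.inner_gradient_le (fun t j => (hΓp t j).1) (fun t j => (hΓw t j).1) t ω
    (h.mem_feasible hst t ω)
  have norm_sq_le := inv_mul_norm_sq_le_sum (Γmax := Γmax)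
    (Γ := Sum.elim (fun a : Fin J × Fin Np => Γp t a.1) fun a : Fin J × Fin Np => Γw t a.1)
    (Sum.rec (fun a => (hΓp t a.1).1) fun a => (hΓw t a.1).1)
    (Sum.rec (fun a => (hΓp t a.1).2) fun a => (hΓw t a.1).2)
    (flatten J Np ((pbar t ω, wbar t ω) - (p t ω, w t ω)))
  rw [← neg_sub (pbar t ω, wbar t ω) (p t ω, w t ω), map_neg] at step
  simp only [PiLp.neg_apply, neg_mul, mul_neg, Finset.sum_neg_distrib] at step
  linarith

theorem stronglyMeasurable_flatten_iterate
    (h : IsRun M ρ γ Γp Γw μ ℱ p w fp fw pbar wbar θ) (t : ℕ) :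
    StronglyMeasurable[ℱ t] fun ω => flatten J Np (p t ω, w t ω) :=
  (flatten J Np).continuous.comp_stronglyMeasurable (h.measurable_iterate t).stronglyMeasurable

theorem flatten_gradient_succ (h : IsRun M ρ γ Γp Γw μ ℱ p w fp fw pbar wbar θ)
    (t : ℕ) (ω : Ω) : flatten J Np (fp (t + 1) ω, fw (t + 1) ω)
      = (1 - ρ t) • flatten J Np (fp t ω, fw t ω) + ρ t •
        (M.flatGrad (flatten J Np (p t ω, w t ω)) + M.gradNoise (p t ω, w t ω) (θ t ω)) := by
  rw [h.gradient_succ, Model.flatGrad_flatten, Model.gradNoise, map_add, map_smul, map_smul,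
    map_sub, add_sub_cancel]

theorem exists_integral_sq_gradNoise_le [IsProbabilityMeasure μ]
    (h : IsRun M ρ γ Γp Γw μ ℱ p w fp fw pbar wbar θ) (hM : M.Regular) (hst : StepRules ρ γ) :
    ∃ σ : ℝ, ∀ t, ∫ ω, ‖M.gradNoise (p t ω, w t ω) (θ t ω)‖ ^ 2 ∂μ ≤ σ ^ 2 := by
  obtain ⟨σ, hσ⟩ := h.exists_ae_norm_gradNoise_le hM hst
  refine ⟨σ, fun t => ?_⟩
  have sq_le : ∀ᵐ ω ∂μ, ‖M.gradNoise (p t ω, w t ω) (θ t ω)‖ ^ 2 ≤ σ ^ 2 :=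
    (hσ t).mono fun ω hω => pow_le_pow_left₀ (norm_nonneg _) hω 2
  calc ∫ ω, ‖M.gradNoise (p t ω, w t ω) (θ t ω)‖ ^ 2 ∂μ
      ≤ ∫ _, σ ^ 2 ∂μ :=
        integral_mono_ae (h.memLp_gradNoise hM hst t 2).integrable_norm_pow' (integrable_const _)
          sq_le
    _ = σ ^ 2 := by rw [integral_const, probReal_univ, one_smul]

theorem exists_averagedGradientRun [IsProbabilityMeasure μ]
    (h : IsRun M ρ γ Γp Γw μ ℱ p w fp fw pbar wbar θ) (hB : 0 < B) (hM : M.Regular)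
    (hst : StepRules ρ γ) {Γmin Γmax : ℝ} (hΓmin : 0 < Γmin)
    (hΓp : ∀ t j, Γp t j ∈ Set.Icc Γmin Γmax) (hΓw : ∀ t j, Γw t j ∈ Set.Icc Γmin Γmax) :
    ∃ ℓ c D σ, AveragedGradientRun (M.flatFeasible Np) M.flatObjective M.flatGrad ℓ c D σ ρ γ μ ℱ
      (fun t ω => flatten J Np (p t ω, w t ω)) (fun t ω => flatten J Np (fp t ω, fw t ω))
      (fun t ω => flatten J Np (pbar t ω, wbar t ω))
      fun t ω => M.gradNoise (p t ω, w t ω) (θ t ω) := by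
  obtain ⟨ℓ, hℓ⟩ := hM.exists_lipschitzOnWith_flatGrad (Np := Np)
  obtain ⟨σ, hσ⟩ := h.exists_integral_sq_gradNoise_le hM hst
  -- For `J = 0` the bounds on the step sizes do not force `0 < Γmax`.
  have hΓmax : 0 < max Γmin Γmax := lt_max_of_lt_left hΓmin
  refine ⟨ℓ, (max Γmin Γmax)⁻¹, Γmin⁻¹, σ, ?_⟩
  exact
    { convex := M.convex_flatFeasible
      isCompact := M.isCompact_flatFeasible
      gradient := fun v hv => hM.hasGradientWithinAt_flatObjective hv
      lipschitz := hℓ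
      mem := fun t ω => M.flatten_mem_flatFeasible.2 (h.mem_feasible hst t ω)
      mem_bar := fun t ω => M.flatten_mem_flatFeasible.2 (h.bar_mem t ω)
      x_succ := fun t ω => by rw [h.iterate_succ, map_add, map_smul, map_sub]
      f_zero := fun ω => by rw [h.fp_zero, h.fw_zero, Prod.mk_zero_zero, map_zero]
      f_succ := h.flatten_gradient_succ
      c_pos := inv_pos.2 hΓmax
      D_nonneg := inv_nonneg.2 hΓmin.le
      descent := fun t ω => by
        rw [← map_sub]
        exact h.inner_gradient_le_neg_norm_sq hst
          (fun t j => ⟨hΓmin.trans_le (hΓp t j).1, (hΓp t j).2.trans (le_max_right _ _)⟩)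
          (fun t j => ⟨hΓmin.trans_le (hΓw t j).1, (hΓw t j).2.trans (le_max_right _ _)⟩) t ω
      optimality := fun t ω y hy => by
        have step := h.inner_gradient_le_mul_norm hΓmin (fun t j => (hΓp t j).1)
          (fun t j => (hΓw t j).1) t ω hy
        rwa [map_sub, map_sub, ContinuousLinearEquiv.apply_symm_apply] at step
      adapted := h.stronglyMeasurable_flatten_iterate
      noise_adapted := h.aestronglyMeasurable_gradNoise hM hst
      noise_memLp := fun t => h.memLp_gradNoise hM hst t 2
      noise_sq_le := hσ
      noise_condExp := h.condExp_gradNoise hB hM hst }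

end IsRun

end PSPVBI

theorem theorem1 {J N Np B : ℕ} (hB : 0 < B) (M : PSPVBI.Model J N) (hM : M.Regular)
    (ρ γ : ℕ → ℝ) (hstep : PSPVBI.StepRules ρ γ)
    (Γp Γw : ℕ → Fin J → ℝ) (Γmin Γmax : ℝ) (hΓmin : 0 < Γmin)
    (hΓp : ∀ t j, Γp t j ∈ Set.Icc Γmin Γmax) (hΓw : ∀ t j, Γw t j ∈ Set.Icc Γmin Γmax)
    {Ω : Type*} {mΩ : MeasurableSpace Ω} (μ : Measure Ω) [IsProbabilityMeasure μ]
    (ℱ : Filtration ℕ mΩ)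
    (p w fp fw pbar wbar : ℕ → Ω → PSPVBI.Particles J Np)
    (θ : ℕ → Ω → Fin B → Fin J → ℝ)
    (hrun : PSPVBI.IsRun M ρ γ Γp Γw μ ℱ p w fp fw pbar wbar θ) :
    ∀ᵐ ω ∂μ, ∀ x : PSPVBI.Particles J Np × PSPVBI.Particles J Np,
      MapClusterPt x atTop (fun t => (p t ω, w t ω)) → M.IsStationary x := by
  obtain ⟨ℓ, c, D, σ, h⟩ := hrun.exists_averagedGradientRun hB hM hstep hΓmin hΓp hΓw
  filter_upwards [h.ae_forall_mapClusterPt hstep] with ω stationary x hx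
  have x_mem : x ∈ M.feasible Np := M.isCompact_feasible.isClosed.mem_of_mapClusterPt hx
    (Eventually.of_forall fun t => hrun.mem_feasible hstep t ω)
  refine ⟨x_mem, PSPVBI.pairing (M.meanGrad x), hM.hasFDerivWithinAt_objective x_mem,
    fun y y_mem => ?_⟩
  have flat_clusterPt : MapClusterPt (PSPVBI.flatten J Np x) atTop
      fun t => PSPVBI.flatten J Np (p t ω, w t ω) :=
    hx.continuousAt_comp (PSPVBI.flatten J Np).continuous.continuousAt
  have gap_nonneg := stationary _ (M.flatten_mem_flatFeasible.2 x_mem) flat_clusterPt _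
    (M.flatten_mem_flatFeasible.2 y_mem)
  rwa [M.flatGrad_flatten, ← map_sub] at gap_nonneg
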